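/- **Theorem 30 (AD dichotomy), a theorem of $\mathrm{ZF}+\mathrm{DC}+\mathrm{AD}$ (that is, it holds in every model of $\mathrm{ZF}+\mathrm{DC}+\mathrm{AD}$).** A *problem* is a partial multivalued function $f:\subseteq\mathbf X\rightrightarrows\mathbf Y$ between represented spaces, i.e. sets $\mathbf X,\mathbf Y$ equipped with partial surjections $\delta_{\mathbf X}:\subseteq\mathbb N^{\mathbb N}\to\mathbf X$, $\delta_{\mathbf Y}:\subseteq\mathbb N^{\mathbb N}\to\mathbf Y$; its domain is $\{x : f(x)\neq\emptyset\}$, and a *name* of $x$ is a point $p$ with $\delta(p)=x$. The space $\mathbb N$ is represented by $q\mapsto q(0)$. For problems $f,g$ write $f\leq_{\mathrm W}^* g$ if there are continuous partial functions $H:\subseteq\mathbb N^{\mathbb N}\to\mathbb N^{\mathbb N}$ and $K:\subseteq\mathbb N^{\mathbb N}\times\mathbb N^{\mathbb N}\to\mathbb N^{\mathbb N}$ such that for every name $p$ of a point $x\in\operatorname{dom}(f)$, $H(p)$ is defined and is a name of a point $z\in\operatorname{dom}(g)$, and for every name $q$ of every element of $g(z)$, $K(p,q)$ is defined and is a name of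 an element of $f(x)$. A *first-order part* ${}^1(f)$ of $f$ is a $\leq_{\mathrm W}^*$-greatest element of $\{g:\subseteq\mathbb N^{\mathbb N}\rightrightarrows\mathbb N \mid g\leq_{\mathrm W}^* f\}$. $\mathrm C_{\mathbb N}$ is the problem: given an enumeration of the complement of a nonempty set $A\subseteq\mathbb N$, find an element of $A$. $\Pi^0_2\mathrm{ACC}_{\mathbb N}$ is the problem: given a $\Pi^0_2$ set $A\subseteq\mathbb N$ with $|\mathbb N\setminus A|\leq 1$ (given by enumerations of sets $U_0,U_1,\dots$ with $A=\bigcap_k U_k$), find an element of $A$. Every problem $f$ has a first-order part, and for every first-order part ${}^1(f)$ of $f$ exactly one of the following holds: 1. ${}^1(f)\leq_{\mathrm W}^*\mathrm C_{\mathbb N}$; 2. $\Pi^0_2\mathrm{ACC}_{\mathbb N}\leq_{\mathrm W}^* f$. -/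

import Mathlib

universe u

namespace WeihrauchAD

/-! ### The language of set theory and its structures

Since the axiom of determinacy contradicts the axiom of choice of the ambient logic, a theorem of
`ZF + DC + AD` is expressed as the truth of its assertion in every structure `(M, ∈ₘ)` for the
language of set theory that satisfies the axioms of `ZF + DC + AD` (by soundness and completeness
of first-order logic this is the same as provability).  Accordingly every object below
(natural numbers, points of Baire space, games, represented spaces, problems, continuous
functions, reductions) is an object of `M`: all quantifiers range over the elements of `M`. -/

/-- A structure for the language of set theory: a type with a binary membership relation. -/
class SetStructure (M : Type u) where
  /-- The membership relation. -/
  mem : M → M → Prop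

/-- The membership relation of the structure. -/
infix:50 " ∈ₘ " => SetStructure.mem

/-- The relation symbols of the language of set theory: one binary symbol. -/
inductive SetRel : ℕ → Type
  | mem : SetRel 2

/-- The first-order language of set theory. -/
abbrev setLang : FirstOrder.Language := ⟨fun _ => Empty, SetRel⟩

instance setLangStructure (M : Type u) [SetStructure M] : setLang.Structure M where
  funMap := fun f _ => Empty.elim f
  RelMap := fun r => match r with
    | SetRel.mem => fun v => v 0 ∈ₘ v 1

section Basic

variable {M : Type u} [SetStructure M]

/-- `e = ∅`. -/
def IsVoid (e : M) : Prop := ∀ x, ¬ x ∈ₘ e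

/-- `s = n ∪ {n}`. -/
def IsSucc (s n : M) : Prop := ∀ x, x ∈ₘ s ↔ x ∈ₘ n ∨ x = n

/-- `w` contains `∅` and is closed under `n ↦ n ∪ {n}`. -/
def IsInductive (w : M) : Prop :=
  (∃ e, IsVoid e ∧ e ∈ₘ w) ∧ ∀ n, n ∈ₘ w → ∃ s, IsSucc s n ∧ s ∈ₘ w

/-- `z = {a, b}`. -/
def IsPair (z a b : M) : Prop := ∀ x, x ∈ₘ z ↔ x = a ∨ x = b

/-- `z = (a, b) = {{a}, {a, b}}`. -/
def IsOPair (z a b : M) : Prop := ∃ s t, IsPair s a a ∧ IsPair t a b ∧ IsPair z s t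

/-- `(a, b) ∈ R`. -/
def Rel (R a b : M) : Prop := ∃ z, IsOPair z a b ∧ z ∈ₘ R

/-- `n` is a natural number, that is, `n ∈ ω`. -/
def IsNat (n : M) : Prop := ∀ w, IsInductive w → n ∈ₘ w

/-- Every element of `F` is an ordered pair `(a, b)` with `P a` and `Q b`. -/
def IsRelation (P Q : M → Prop) (F : M) : Prop :=
  ∀ z, z ∈ₘ F → ∃ a b, P a ∧ Q b ∧ IsOPair z a b

/-- `F` is a partial function from `{a | P a}` to `{b | Q b}`. -/
def IsPartialMap (P Q : M → Prop) (F : M) : Prop :=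
  IsRelation P Q F ∧ ∀ a b b', Rel F a b → Rel F a b' → b = b'

/-- `F` is a function from `{a | P a}` to `{b | Q b}`. -/
def IsMap (P Q : M → Prop) (F : M) : Prop :=
  IsPartialMap P Q F ∧ ∀ a, P a → ∃ b, Rel F a b

/-- `p` is a point of Baire space: a function from `ω` to `ω`. -/
def IsBaire (p : M) : Prop := IsMap IsNat IsNat p

/-- `s` is a finite sequence of natural numbers: a function from some `n ∈ ω` to `ω`. -/
def IsFinSeq (s : M) : Prop := ∃ n, IsNat n ∧ IsMap (fun k => k ∈ₘ n) IsNat s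

/-- `s` is the restriction of the relation (or function) `p` to `n`. -/
def IsRestr (s p n : M) : Prop :=
  ∀ z, z ∈ₘ s ↔ z ∈ₘ p ∧ ∃ k v, k ∈ₘ n ∧ IsOPair z k v

end Basic

/-! ### The axioms -/

/-- The axioms of Zermelo–Fraenkel set theory (without choice). In the two schemes `φ` runs over
the formulas of the language of set theory; `v` supplies the parameters. -/
structure IsZF (M : Type u) [SetStructure M] : Prop where
  extensionality : ∀ a b : M, (∀ x, x ∈ₘ a ↔ x ∈ₘ b) → a = b
  foundation : ∀ a : M, (∃ x, x ∈ₘ a) → ∃ x, x ∈ₘ a ∧ ∀ y, y ∈ₘ x → ¬ y ∈ₘ a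
  pairing : ∀ a b : M, ∃ c, ∀ x, x ∈ₘ c ↔ x = a ∨ x = b
  union : ∀ a : M, ∃ c, ∀ x, x ∈ₘ c ↔ ∃ y, y ∈ₘ a ∧ x ∈ₘ y
  powerset : ∀ a : M, ∃ c, ∀ x, x ∈ₘ c ↔ ∀ y, y ∈ₘ x → y ∈ₘ a
  infinity : ∃ w : M, IsInductive w
  separation : ∀ (φ : setLang.Formula ℕ) (v : ℕ → M) (a : M), ∃ c, ∀ x, x ∈ₘ c ↔
    x ∈ₘ a ∧ φ.Realize (Function.update v 0 x)
  replacement : ∀ (φ : setLang.Formula ℕ) (v : ℕ → M) (a : M),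
    (∀ x, x ∈ₘ a → ∃! y, φ.Realize (Function.update (Function.update v 0 x) 1 y)) →
    ∃ c, ∀ y, y ∈ₘ c ↔
      ∃ x, x ∈ₘ a ∧ φ.Realize (Function.update (Function.update v 0 x) 1 y)

/-- The axiom of dependent choices. -/
def DC (M : Type u) [SetStructure M] : Prop :=
  ∀ A R : M, (∃ a, a ∈ₘ A) → (∀ a, a ∈ₘ A → ∃ b, b ∈ₘ A ∧ Rel R a b) →
    ∃ s, IsMap IsNat (fun a => a ∈ₘ A) s ∧
      ∀ n n' a b, IsNat n → IsSucc n' n → Rel s n a → Rel s n' b → Rel R a b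

/-- The axiom of determinacy. Player I plays `x 0, x 1, …`, player II plays `y 0, y 1, …`, in the
order `x 0, y 0, x 1, y 1, …`, and player I wins iff `(x, y)` belongs to the payoff set `A`.
A strategy is a function that assigns a move to each finite sequence of moves of the opponent.
One of the players has a winning strategy. -/
def AD (M : Type u) [SetStructure M] : Prop :=
  ∀ A : M,
    (∃ σ, IsMap IsFinSeq IsNat σ ∧ ∀ x y, IsBaire x → IsBaire y →
      (∀ n s k, IsNat n → IsRestr s y n → Rel x n k → Rel σ s k) → Rel A x y) ∨
    (∃ τ, IsMap IsFinSeq IsNat τ ∧ ∀ x y, IsBaire x → IsBaire y →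
      (∀ n n' s k, IsNat n → IsSucc n' n → IsRestr s x n' → Rel y n k → Rel τ s k) →
        ¬ Rel A x y)

/-! ### Problems on represented spaces -/

/-- A represented space: a set with a partial surjection from Baire space onto it. -/
structure RepSpace (M : Type u) [SetStructure M] where
  /-- The underlying set. -/
  carrier : M
  /-- The representation; `Rel rep p x` says that `p` is a name of `x`. -/
  rep : M
  rep_partialMap : IsPartialMap IsBaire (fun x => x ∈ₘ carrier) rep
  rep_surjective : ∀ x, x ∈ₘ carrier → ∃ p, Rel rep p x

/-- A problem: a partial multivalued function between represented spaces, given by its graph.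
Its domain consists of the points that have at least one value. -/
structure Problem (M : Type u) [SetStructure M] where
  /-- The space of instances. -/
  source : RepSpace M
  /-- The space of solutions. -/
  target : RepSpace M
  /-- The graph; `Rel graph x y` says that `y` is a solution to the instance `x`. -/
  graph : M
  graph_relation :
    IsRelation (fun x => x ∈ₘ source.carrier) (fun y => y ∈ₘ target.carrier) graph

section Weihrauch

variable {M : Type u} [SetStructure M]

/-- The problem on the level of names: `p` is a name of some `x` in the domain, and `q` is a name
of some solution to `x`. -/
def Problem.onNames (f : Problem M) (p q : M) : Prop :=
  ∃ x y, Rel f.source.rep p x ∧ Rel f.target.rep q y ∧ Rel f.graph x y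

/-- `p` and `q` agree on all arguments below `n`. -/
def Agree (n p q : M) : Prop := ∀ k, k ∈ₘ n → ∀ v, Rel p k v ↔ Rel q k v

/-- `z` is an ordered pair of points of Baire space. -/
def IsBairePair (z : M) : Prop := ∃ p q, IsBaire p ∧ IsBaire q ∧ IsOPair z p q

/-- `H` is a continuous partial function from Baire space to Baire space. -/
def IsContinuous (H : M) : Prop :=
  IsPartialMap IsBaire IsBaire H ∧
    ∀ p r, Rel H p r → ∀ n, IsNat n → ∃ m, IsNat m ∧
      ∀ p' r', Rel H p' r' → Agree m p p' → Agree n r r'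

/-- `K (p, q) = r`. -/
def Rel₂ (K p q r : M) : Prop := ∃ z, IsOPair z p q ∧ Rel K z r

/-- `K` is a continuous partial function from the square of Baire space to Baire space. -/
def IsContinuous₂ (K : M) : Prop :=
  IsPartialMap IsBairePair IsBaire K ∧
    ∀ p q r, Rel₂ K p q r → ∀ n, IsNat n → ∃ m, IsNat m ∧
      ∀ p' q' r', Rel₂ K p' q' r' → Agree m p p' → Agree m q q' → Agree n r r'

/-- Continuous Weihrauch reducibility of problems on the level of names (the names of instances
are those `p` that are related to some `q`): there are continuous `H` and `K` such that `H`
maps every name `p` of an instance of the first problem to a name `H p` of an instance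
of the second one, and `K` maps `(p, q)`, for every name `q` of every solution to that instance,
to a name of a solution to the original instance. -/
def ContRed (F G : M → M → Prop) : Prop :=
  ∃ H K, IsContinuous H ∧ IsContinuous₂ K ∧
    ∀ p, (∃ r, F p r) → ∃ p', Rel H p p' ∧ (∃ q, G p' q) ∧
      ∀ q, G p' q → ∃ r, Rel₂ K p q r ∧ F p r

/-- `q` is a name of the natural number `n`, that is, `q 0 = n`. -/
def NamesNat (q n : M) : Prop := IsBaire q ∧ IsNat n ∧ ∃ e, IsVoid e ∧ Rel q e n

/-- `g` is (the graph of) a first-order problem: a partial multivalued function from Baire space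
to `ω`. -/
def IsFirstOrder (g : M) : Prop := IsRelation IsBaire IsNat g

/-- A first-order problem on the level of names. -/
def firstOrderOnNames (g : M) (p q : M) : Prop := ∃ n, NamesNat q n ∧ Rel g p n

/-- `g` is a first-order part of `f`: a greatest element, with respect to continuous Weihrauch
reducibility, among the first-order problems that are reducible to `f`. -/
def IsFirstOrderPart (f : Problem M) (g : M) : Prop :=
  IsFirstOrder g ∧ ContRed (firstOrderOnNames g) f.onNames ∧
    ∀ h, IsFirstOrder h → ContRed (firstOrderOnNames h) f.onNames →
      ContRed (firstOrderOnNames h) (firstOrderOnNames g)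

/-- `n` is enumerated by `p`, that is, `p i = n + 1` for some `i` (the value `0` enumerates
nothing). -/
def Enumerates (p n : M) : Prop := ∃ i s, IsSucc s n ∧ Rel p i s

/-- Closed choice on `ω`: given an enumeration `p` of the complement of a nonempty set, find an
element of the set. -/
def closedChoice (p q : M) : Prop :=
  IsBaire p ∧ ∃ n, NamesNat q n ∧ ¬ Enumerates p n

/-- `d` is the function `n ↦ 2 n` on `ω`. -/
def IsDouble (d : M) : Prop :=
  IsBaire d ∧ (∀ e, IsVoid e → Rel d e e) ∧
    ∀ n n' k k' k'', IsSucc n' n → Rel d n k → IsSucc k' k → IsSucc k'' k' → Rel d n' k''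

/-- `z` is an ordered pair of natural numbers. -/
def IsNatPair (z : M) : Prop := ∃ a b, IsNat a ∧ IsNat b ∧ IsOPair z a b

/-- `c` is the pairing function `(a, b) ↦ ⟨a, b⟩ = 2 ^ a * (2 * b + 1) - 1`, a bijection from
`ω × ω` to `ω`: it satisfies `⟨0, b⟩ = 2 b` and `⟨a + 1, b⟩ = 2 ⟨a, b⟩ + 1`. -/
def IsPairing (c : M) : Prop :=
  IsMap IsNatPair IsNat c ∧ ∃ d, IsDouble d ∧
    (∀ e b k, IsVoid e → Rel d b k → Rel₂ c e b k) ∧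
    ∀ a a' b k l l', IsSucc a' a → Rel₂ c a b k → Rel d k l → IsSucc l' l → Rel₂ c a' b l'

/-- `r` is the section `p_k`, given by `p_k j = p ⟨k, j⟩`. -/
def IsSection (r p k : M) : Prop :=
  IsBaire r ∧ ∃ c, IsPairing c ∧
    ∀ j i v, Rel₂ c k j i → Rel p i v → Rel r j v

/-- `n` belongs to the `Π⁰₂` subset of `ω` named by `p`, which is the intersection of the open sets
`U_k`, where `U_k` is the set enumerated by the section `p_k`. -/
def InPi2 (p n : M) : Prop := ∀ k, IsNat k → ∃ r, IsSection r p k ∧ Enumerates r n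

/-- The problem `Π⁰₂ACC` on `ω`: given a `Π⁰₂` subset of `ω` whose complement has at most one
element, find an element of the set. -/
def pi2ACC (p q : M) : Prop :=
  IsBaire p ∧
    (∀ m n, IsNat m → IsNat n → ¬ InPi2 p m → ¬ InPi2 p n → m = n) ∧
    ∃ n, NamesNat q n ∧ InPi2 p n

end Weihrauch

end WeihrauchAD

open WeihrauchAD

namespace WeihrauchAD

open FirstOrder Language

set_option synthInstance.maxSize 100000
set_option synthInstance.maxHeartbeats 400000

/-! The heart is a game. For a first-order problem `F`, player I builds `x` and player II builds
`y`; I wins iff `x` is an instance of `F` and no solution of `x` is the limit of `y`. By AD one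
player has a winning strategy, and a strategy is a continuous map, since each move depends on
finitely many moves of the opponent.

If I wins, the strategy turns `y` into an instance of `F` all of whose solutions avoid the limit of
`y` (`red_of_strategy`). So the problem `NotLimit` reduces to `F`, and `NotLimit` is equivalent to
`Π⁰₂ACC` (`red_notLimit_pi2Choice`, `red_pi2Choice_notLimit`): being a non-limit is a `Π⁰₂`
condition failing for at most one number, and conversely the only possible missing element is the
limit of a sequence of guesses. If II wins, an instance `x` is turned into a sequence converging to
a solution of `x`. Closed choice finds a stage after which it is constant, so `F` reduces to `C_ℕ`
(`red_unenumerated_of_strategy`). The alternatives exclude each other because `NotLimit` does not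
reduce to closed choice, by a Baire category argument (`not_red_notLimit`).

A first-order part always exists: an instance of `Universal` is an instance of `f` together with a
code of a continuous function from its solutions to numbers. The dichotomy for `f` is the one for
its first-order part, since `Π⁰₂ACC` is itself first-order and hence lies below `f` iff it lies
below that part.

All of this happens inside a model whose `ω` may be nonstandard and which need not contain what the
ambient logic can choose. Sets, induction, recursion and minimization are available only for
predicates definable with parameters. The classes `Dfn` and `DFun` leave the definability checks to
instance search, so that the mathematics can be written with the types `Omega M` and `Baire M`
almost as usual. Objects picked by choice are harmless when they are single parameters, or when
uniqueness makes the resulting function definable. -/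

/-- Being a model of the Zermelo–Fraenkel axioms, as a class. -/
class ZFModel (M : Type u) [SetStructure M] : Prop where
  zf : IsZF M

/-! ### Predicates definable with parameters -/

section Definability

variable {M : Type u} [SetStructure M]

/-- A predicate of assignments of the variables that is given by a formula with parameters. -/
def Definable (P : (ℕ → M) → Prop) : Prop :=
  ∃ φ : setLang.Formula (ℕ ⊕ M), ∀ v, φ.Realize (Sum.elim v id) ↔ P v

namespace Definable

theorem congr {P Q : (ℕ → M) → Prop} (h : Definable P) (e : ∀ v, P v ↔ Q v) : Definable Q := by
  obtain ⟨φ, hφ⟩ := h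
  exact ⟨φ, fun v => (hφ v).trans (e v)⟩

theorem mem (i j : ℕ) : Definable fun v : ℕ → M => v i ∈ₘ v j := by
  refine ⟨Relations.formula₂ (L := setLang) SetRel.mem
    (Term.var (Sum.inl i)) (Term.var (Sum.inl j)), fun v => ?_⟩
  rw [Formula.realize_rel₂]
  rfl

theorem eq (i j : ℕ) : Definable fun v : ℕ → M => v i = v j := by
  refine ⟨Term.equal (Term.var (Sum.inl i)) (Term.var (Sum.inl j)), fun v => ?_⟩
  rw [Formula.realize_equal]
  rfl

theorem eq_param (i : ℕ) (c : M) : Definable fun v : ℕ → M => v i = c := by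
  refine ⟨Term.equal (Term.var (Sum.inl i)) (Term.var (Sum.inr c)), fun v => ?_⟩
  rw [Formula.realize_equal]
  rfl

theorem not {P : (ℕ → M) → Prop} (h : Definable P) : Definable fun v => ¬ P v := by
  obtain ⟨φ, hφ⟩ := h
  exact ⟨φ.not, fun v => by rw [Formula.realize_not, hφ]⟩

theorem and {P Q : (ℕ → M) → Prop} (h : Definable P) (h' : Definable Q) :
    Definable fun v => P v ∧ Q v := by
  obtain ⟨φ, hφ⟩ := h
  obtain ⟨ψ, hψ⟩ := h'
  exact ⟨φ ⊓ ψ, fun v => by rw [Formula.realize_inf, hφ, hψ]⟩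

theorem imp {P Q : (ℕ → M) → Prop} (h : Definable P) (h' : Definable Q) :
    Definable fun v => P v → Q v :=
  (h.and h'.not).not.congr fun v => by tauto

theorem or {P Q : (ℕ → M) → Prop} (h : Definable P) (h' : Definable Q) :
    Definable fun v => P v ∨ Q v :=
  (h.not.and h'.not).not.congr fun v => by tauto

theorem iff {P Q : (ℕ → M) → Prop} (h : Definable P) (h' : Definable Q) :
    Definable fun v => (P v ↔ Q v) :=
  ((h.imp h').and (h'.imp h)).congr fun v => by tauto

theorem reindex {P : (ℕ → M) → Prop} (h : Definable P) (s : ℕ → ℕ) :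
    Definable fun v => P fun k => v (s k) := by
  obtain ⟨φ, hφ⟩ := h
  refine ⟨φ.relabel (Sum.map s id), fun v => ?_⟩
  rw [Formula.realize_relabel]
  have : (Sum.elim v id ∘ Sum.map s id : ℕ ⊕ M → M) = Sum.elim (fun k => v (s k)) id := by
    ext x; cases x <;> rfl
  rw [this]
  exact hφ fun k => v (s k)

theorem var {P : M → Prop} (h : Definable fun v : ℕ → M => P (v 0)) (i : ℕ) :
    Definable fun v : ℕ → M => P (v i) :=
  h.reindex fun _ => i

/-- Existential quantification over the variable `n`. -/
theorem ex (n : ℕ) {Q : M → (ℕ → M) → Prop} (h : Definable fun v => Q (v n) v)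
    (hn : ∀ x v y, Q x (Function.update v n y) ↔ Q x v) : Definable fun v => ∃ x, Q x v := by
  obtain ⟨φ, hφ⟩ := h
  -- The variable `n` is turned into the bound variable. By `hn`, `Q x` does not read `n`, so `n`
  -- acts as a fresh name.
  refine ⟨Formula.iExs (α := ℕ ⊕ M) Unit (φ.relabel (Sum.elim
    (fun k => if k = n then Sum.inr () else Sum.inl (Sum.inl k))
    (fun m => Sum.inl (Sum.inr m)))), fun v => ?_⟩
  rw [Formula.realize_iExs]
  have key : ∀ x : M, (φ.relabel (Sum.elim
      (fun k => if k = n then Sum.inr () else Sum.inl (Sum.inl k))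
      (fun m => Sum.inl (Sum.inr m))) : setLang.Formula ((ℕ ⊕ M) ⊕ Unit)).Realize
        (Sum.elim (Sum.elim v id) fun _ => x) ↔ Q x v := by
    intro x
    rw [Formula.realize_relabel, ← hn x v x]
    have := hφ (Function.update v n x)
    simp only [Function.update_self] at this
    rw [← this]
    have e : (Sum.elim (Sum.elim v id) (fun _ : Unit => x) ∘ Sum.elim
        (fun k => if k = n then Sum.inr () else Sum.inl (Sum.inl k))
        (fun m => Sum.inl (Sum.inr m)) : ℕ ⊕ M → M) = Sum.elim (Function.update v n x) id := by
      ext y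
      rcases y with k | m
      · by_cases hk : k = n
        · subst hk; simp
        · simp [hk]
      · rfl
    rw [e]
  constructor
  · rintro ⟨i, hi⟩
    exact ⟨i (), (key _).1 hi⟩
  · rintro ⟨x, hx⟩
    exact ⟨fun _ => x, (key _).2 hx⟩

theorem all (n : ℕ) {Q : M → (ℕ → M) → Prop} (h : Definable fun v => Q (v n) v)
    (hn : ∀ x v y, Q x (Function.update v n y) ↔ Q x v) : Definable fun v => ∀ x, Q x v :=
  (ex n (Q := fun x v => ¬ Q x v) h.not fun x v y => not_congr (hn x v y)).not.congr
    fun v => by simp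

theorem const (c : Prop) : Definable fun _ : ℕ → M => c := by
  by_cases hc : c
  · exact (eq 0 0).congr fun v => by simp [hc]
  · exact (eq 0 0).not.congr fun v => by simp [hc]

theorem isPair (i j k : ℕ) (hi : i < 10) (hj : j < 10) (hk : k < 10) :
    Definable fun v : ℕ → M => IsPair (v i) (v j) (v k) := by
  unfold IsPair
  refine all 10 ((mem 10 i).iff ((eq 10 j).or (eq 10 k))) fun x v y => ?_
  simp [Function.update_of_ne, hi.ne, hj.ne, hk.ne]

theorem isOPair (i j k : ℕ) (hi : i < 8) (hj : j < 8) (hk : k < 8) :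
    Definable fun v : ℕ → M => IsOPair (v i) (v j) (v k) := by
  unfold IsOPair
  refine ex 8 (ex 9 (((isPair 8 j j ?_ ?_ ?_).and ((isPair 9 j k ?_ ?_ ?_).and
    (isPair i 8 9 ?_ ?_ ?_)))) fun x v y => ?_) fun x v y => ?_ <;>
    first
    | omega
    | simp [hi.ne, hj.ne, hk.ne, (hi.trans (Nat.lt_succ_self 8)).ne,
        (hj.trans (Nat.lt_succ_self 8)).ne, (hk.trans (Nat.lt_succ_self 8)).ne]

/-- The axiom scheme has formulas over `ℕ` and keeps parameters in the assignment. Only finitely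
many parameters occur in `φ`; they are numbered and moved to the variables `1, 2, …`, leaving
variable `0` for the element. -/
theorem separation [ZFModel M] {P : M → Prop} (h : Definable fun v : ℕ → M => P (v 0)) (a : M) :
    ∃ c, ∀ x, x ∈ₘ c ↔ x ∈ₘ a ∧ P x := by
  classical
  obtain ⟨φ, hφ⟩ := h
  let e := Fintype.equivFin φ.freeVarFinset
  let ind : φ.freeVarFinset → ℕ := fun z => match z.1 with
    | Sum.inl _ => 0
    | Sum.inr _ => (e z : ℕ) + 1
  let w : ℕ → M := fun j => match j with
    | 0 => a
    | j + 1 => if hj : j < Fintype.card φ.freeVarFinset then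
        Sum.elim (fun _ => a) id (e.symm ⟨j, hj⟩).1 else a
  have hw : ∀ z : φ.freeVarFinset, w (e z + 1) = Sum.elim (fun _ => a) id z.1 := fun z => by
    simp only [w, (e z).2, dif_pos, Fin.eta, Equiv.symm_apply_apply]
  obtain ⟨c, hc⟩ := (ZFModel.zf (M := M)).separation (φ.restrictFreeVar ind) w a
  refine ⟨c, fun x => (hc x).trans (and_congr_right fun _ => ?_)⟩
  -- `P` reads only the variable `0`, so the constant assignment may be used; hence every ordinary
  -- variable can be identified with `0`.
  refine Iff.trans ?_ (hφ fun _ => x)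
  refine BoundedFormula.realize_restrictFreeVar (Sum.elim (fun _ => x) id) ?_
  rintro ⟨z | m, hz⟩
  · simp [ind]
  · simpa [ind] using hw ⟨Sum.inr m, hz⟩

end Definable

end Definability

/-! ### Pairs -/

section Pairs

variable {M : Type u} [SetStructure M] [ZFModel M]

theorem set_ext {a b : M} (h : ∀ x, x ∈ₘ a ↔ x ∈ₘ b) : a = b := ZFModel.zf.extensionality a b h

theorem exists_isPair (a b : M) : ∃ z, IsPair z a b := ZFModel.zf.pairing a b

theorem IsPair.unique {z z' a b : M} (h : IsPair z a b) (h' : IsPair z' a b) : z = z' :=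
  set_ext fun x => (h x).trans (h' x).symm

theorem exists_isOPair (a b : M) : ∃ z, IsOPair z a b := by
  obtain ⟨s, hs⟩ := exists_isPair a a
  obtain ⟨t, ht⟩ := exists_isPair a b
  obtain ⟨z, hz⟩ := exists_isPair s t
  exact ⟨z, s, t, hs, ht, hz⟩

/-- The ordered pair. -/
noncomputable def opair (a b : M) : M := (exists_isOPair a b).choose

theorem isOPair_opair (a b : M) : IsOPair (opair a b) a b := (exists_isOPair a b).choose_spec

theorem isOPair_iff {z a b : M} : IsOPair z a b ↔ z = opair a b := by
  constructor
  · rintro ⟨s, t, hs, ht, hz⟩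
    obtain ⟨s', t', hs', ht', hz'⟩ := isOPair_opair a b
    obtain rfl := hs.unique hs'
    obtain rfl := ht.unique ht'
    exact hz.unique hz'
  · rintro rfl
    exact isOPair_opair a b

theorem opair_inj {a b a' b' : M} : opair a b = opair a' b' ↔ a = a' ∧ b = b' := by
  refine ⟨fun h => ?_, fun h => by rw [h.1, h.2]⟩
  obtain ⟨s, t, hs, ht, hz⟩ := isOPair_opair a b
  obtain ⟨s', t', hs', ht', hz'⟩ := isOPair_opair a' b'
  rw [h] at hz
  have h1 : s = s' ∨ s = t' := (hz' s).1 ((hz s).2 (Or.inl rfl))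
  have h2 : t = s' ∨ t = t' := (hz' t).1 ((hz t).2 (Or.inr rfl))
  have h3 : s' = s ∨ s' = t := (hz s').1 ((hz' s').2 (Or.inl rfl))
  have h4 : t' = s ∨ t' = t := (hz t').1 ((hz' t').2 (Or.inr rfl))
  have haa : a = a' := by
    rcases h1 with rfl | rfl
    · simpa using (hs' a).1 ((hs a).2 (Or.inl rfl))
    · exact ((or_self_iff.1 ((hs a').1 ((ht' a').2 (Or.inl rfl))))).symm
  subst haa
  obtain rfl := hs.unique hs'
  refine ⟨rfl, ?_⟩
  have mb : b = a ∨ b = b' := by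
    rcases h2 with rfl | rfl
    · exact Or.inl (by simpa using (hs b).1 ((ht b).2 (Or.inr rfl)))
    · exact (ht' b).1 ((ht b).2 (Or.inr rfl))
  have mb' : b' = a ∨ b' = b := by
    rcases h4 with rfl | rfl
    · exact Or.inl (by simpa using (hs b').1 ((ht' b').2 (Or.inr rfl)))
    · exact (ht b').1 ((ht' b').2 (Or.inr rfl))
  rcases mb with rfl | h
  · rcases mb' with h | h <;> exact h.symm
  · exact h

theorem rel_iff {R a b : M} : Rel R a b ↔ opair a b ∈ₘ R := by
  simp [Rel, isOPair_iff]

theorem rel₂_iff {K p q r : M} : Rel₂ K p q r ↔ opair (opair p q) r ∈ₘ K := by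
  simp [Rel₂, isOPair_iff, rel_iff]

end Pairs

/-! ### Definable predicates and functions on types coded in the model -/

/-- A type whose elements are coded by the elements of a definable class. -/
class Coded (M : Type u) [SetStructure M] (X : Type u) where
  /-- The code of an element. -/
  code : X → M
  code_injective : Function.Injective code
  definable_range : Definable fun v : ℕ → M => ∃ x, code x = v 0

open Coded

/-- A predicate on a coded type that is definable with parameters. -/
class Dfn (M : Type u) [SetStructure M] {X : Type u} [Coded M X] (P : X → Prop) : Prop where
  definable : Definable fun v : ℕ → M => ∃ x, code x = v 0 ∧ P x

section Typed

variable {M : Type u} [SetStructure M] {X Y Z : Type u} [Coded M X] [Coded M Y] [Coded M Z]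

theorem Coded.range_var (X : Type u) [Coded M X] (i : ℕ) :
    Definable fun v : ℕ → M => ∃ x : X, code x = v i :=
  Definable.var (P := fun m => ∃ x : X, code x = m) Coded.definable_range i

theorem Dfn.var {P : X → Prop} (h : Dfn M P) (i : ℕ) :
    Definable fun v : ℕ → M => ∃ x, code x = v i ∧ P x :=
  Definable.var (P := fun m => ∃ x, code x = m ∧ P x) h.definable i

theorem Coded.code_inj {x y : X} : (code x : M) = code y ↔ x = y :=
  Coded.code_injective.eq_iff

theorem Coded.exists_code_eq {x : X} {P : X → Prop} :
    (∃ y, (code y : M) = code x ∧ P y) ↔ P x := by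
  simp [Coded.code_inj]

theorem Dfn.congr {P Q : X → Prop} (h : Dfn M P) (e : ∀ x, P x ↔ Q x) : Dfn M Q := by
  rwa [← funext fun x => propext (e x)]

instance Coded.self : Coded M M where
  code := id
  code_injective := Function.injective_id
  definable_range := (Definable.const True).congr fun v => by simp

instance Dfn.not {P : X → Prop} [h : Dfn M P] : Dfn M fun x => ¬ P x where
  definable := ((Coded.range_var X 0).and h.definable.not).congr fun v => by
    constructor
    · rintro ⟨⟨x, hx⟩, h⟩
      exact ⟨x, hx, fun hP => h ⟨x, hx, hP⟩⟩
    · rintro ⟨x, hx, hP⟩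
      refine ⟨⟨x, hx⟩, ?_⟩
      rw [← hx, Coded.exists_code_eq]
      exact hP

instance Dfn.and {P Q : X → Prop} [h : Dfn M P] [h' : Dfn M Q] : Dfn M fun x => P x ∧ Q x where
  definable := (h.definable.and h'.definable).congr fun v => by
    constructor
    · rintro ⟨⟨x, hx, hP⟩, h⟩
      rw [← hx, Coded.exists_code_eq] at h
      exact ⟨x, hx, hP, h⟩
    · rintro ⟨x, hx, hP, hQ⟩
      exact ⟨⟨x, hx, hP⟩, x, hx, hQ⟩

instance Dfn.or {P Q : X → Prop} [h : Dfn M P] [h' : Dfn M Q] : Dfn M fun x => P x ∨ Q x :=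
  (inferInstance : Dfn M fun x => ¬ (¬ P x ∧ ¬ Q x)).congr fun x => by tauto

instance Dfn.imp {P Q : X → Prop} [h : Dfn M P] [h' : Dfn M Q] : Dfn M fun x => P x → Q x :=
  (inferInstance : Dfn M fun x => ¬ (P x ∧ ¬ Q x)).congr fun x => by tauto

instance Dfn.iff {P Q : X → Prop} [h : Dfn M P] [h' : Dfn M Q] : Dfn M fun x => (P x ↔ Q x) :=
  (inferInstance : Dfn M fun x => (P x → Q x) ∧ (Q x → P x)).congr fun x => by tauto

instance Dfn.const (c : Prop) : Dfn M fun _ : X => c where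
  definable := ((Coded.range_var X 0).and (Definable.const c)).congr fun v => by simp

variable [ZFModel M]

noncomputable instance Coded.prod : Coded M (X × Y) where
  code p := opair (code p.1) (code p.2)
  code_injective p q h := by
    obtain ⟨h1, h2⟩ := opair_inj.1 h
    exact Prod.ext (Coded.code_injective h1) (Coded.code_injective h2)
  definable_range := by
    refine (Definable.ex 1 (Definable.ex 2 ((Coded.range_var X 1).and
      ((Coded.range_var Y 2).and (Definable.isOPair 0 1 2 ?_ ?_ ?_))) fun x v y => ?_)
        fun x v y => ?_).congr (P := fun v => ∃ a b, (∃ x : X, code x = a) ∧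
          (∃ y : Y, code y = b) ∧ IsOPair (v 0) a b) fun v => ?_
    any_goals omega
    any_goals (simp; done)
    simp only [isOPair_iff, Prod.exists]
    constructor
    · rintro ⟨_, _, ⟨x, rfl⟩, ⟨y, rfl⟩, h⟩
      exact ⟨x, y, h.symm⟩
    · rintro ⟨x, y, h⟩
      exact ⟨_, _, ⟨x, rfl⟩, ⟨y, rfl⟩, h.symm⟩

theorem code_prod (p : X × Y) : (code p : M) = opair (code p.1) (code p.2) := rfl

theorem exists_code_prod_eq {x : X} {y : Y} {P : X × Y → Prop} :
    (∃ e : X × Y, (code e : M) = opair (code x) (code y) ∧ P e) ↔ P (x, y) :=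
  Coded.exists_code_eq (x := (x, y))

/-- Uncurrying is what lets instance search pass under a quantifier: the bound variable becomes the
second projection of a product. -/
instance Dfn.ex {P : X → Y → Prop} [h : Dfn M fun e : X × Y => P e.1 e.2] :
    Dfn M fun x => ∃ y, P x y where
  definable := by
    refine (Definable.ex 1 (Definable.ex 2 ((Definable.isOPair 2 0 1 ?_ ?_ ?_).and (h.var 2))
      fun x v y => ?_) fun x v y => ?_).congr (P := fun v => ∃ a b, IsOPair b (v 0) a ∧
          (∃ e : X × Y, code e = b ∧ P e.1 e.2)) fun v => ?_
    any_goals omega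
    any_goals (simp; done)
    simp only [isOPair_iff, Prod.exists, code_prod]
    constructor
    · rintro ⟨a, _, rfl, x, y, h, hP⟩
      exact ⟨x, (opair_inj.1 h).1, y, hP⟩
    · rintro ⟨x, h, y, hP⟩
      exact ⟨code y, _, rfl, x, y, by rw [h], hP⟩

instance Dfn.all {P : X → Y → Prop} [h : Dfn M fun e : X × Y => P e.1 e.2] :
    Dfn M fun x => ∀ y, P x y :=
  (inferInstance : Dfn M fun x => ¬ ∃ y, ¬ P x y).congr fun x => by simp

/-- A function between coded types that is definable with parameters. -/
class DFun (M : Type u) [SetStructure M] [ZFModel M] {X Y : Type u} [Coded M X] [Coded M Y]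
    (f : X → Y) : Prop where
  graph : Dfn M fun e : X × Y => f e.1 = e.2

theorem DFun.var {f : X → Y} (h : DFun M f) (i : ℕ) :
    Definable fun v : ℕ → M => ∃ e : X × Y, code e = v i ∧ f e.1 = e.2 :=
  h.graph.var i

/-- Substitution goes through the graph: `P (f x)` says that some `y` with `f x = y` satisfies `P`.
-/
theorem Dfn.comp {P : Y → Prop} (h : Dfn M P) (f : X → Y) [hf : DFun M f] :
    Dfn M fun x => P (f x) where
  definable := by
    refine (Definable.ex 1 (Definable.ex 2 ((Definable.isOPair 2 0 1 ?_ ?_ ?_).and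
      ((hf.var 2).and (h.var 1)))
      fun x v y => ?_) fun x v y => ?_).congr (P := fun v => ∃ a b, IsOPair b (v 0) a ∧
          (∃ e : X × Y, code e = b ∧ f e.1 = e.2) ∧ ∃ y, code y = a ∧ P y) fun v => ?_
    any_goals omega
    any_goals (simp; done)
    simp only [isOPair_iff, Prod.exists, code_prod]
    constructor
    · rintro ⟨a, _, rfl, ⟨x, y, h, rfl⟩, y, rfl, hP⟩
      obtain ⟨h1, h2⟩ := opair_inj.1 h
      obtain rfl := Coded.code_injective h2
      exact ⟨x, h1, hP⟩
    · rintro ⟨x, h, hP⟩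
      exact ⟨code (f x), _, rfl, ⟨x, f x, by rw [h], rfl⟩, _, rfl, hP⟩

instance DFun.id : DFun M fun x : X => x where
  graph.definable := by
    refine (Definable.ex 1 ((Definable.isOPair 0 1 1 ?_ ?_ ?_).and (Coded.range_var X 1))
      fun x v y => ?_).congr (P := fun v => ∃ a, IsOPair (v 0) a a ∧ ∃ x : X, code x = a)
        fun v => ?_
    any_goals omega
    any_goals (simp; done)
    simp only [isOPair_iff, Prod.exists, code_prod]
    constructor
    · rintro ⟨a, h, x, rfl⟩
      exact ⟨x, x, h.symm, rfl⟩
    · rintro ⟨x, y, h, rfl⟩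
      exact ⟨_, h.symm, x, rfl⟩

theorem DFun.projFst : DFun M fun e : X × Y => e.1 where
  graph.definable := by
    refine (Definable.ex 1 (Definable.ex 2 (Definable.ex 3 ((Definable.isOPair 0 3 1 ?_ ?_ ?_).and
      ((Definable.isOPair 3 1 2 ?_ ?_ ?_).and ((Coded.range_var X 1).and (Coded.range_var Y 2))))
      fun x v y => ?_) fun x v y => ?_) fun x v y => ?_).congr (P := fun v => ∃ a b w,
        IsOPair (v 0) w a ∧ IsOPair w a b ∧ (∃ x : X, code x = a) ∧ ∃ y : Y, code y = b)
        fun v => ?_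
    any_goals omega
    any_goals (simp; done)
    simp only [isOPair_iff, Prod.exists, code_prod]
    constructor
    · rintro ⟨_, _, _, h, rfl, ⟨x, rfl⟩, y, rfl⟩
      exact ⟨x, y, x, h.symm, rfl⟩
    · rintro ⟨x, y, _, h, rfl⟩
      exact ⟨_, _, _, h.symm, rfl, ⟨x, rfl⟩, y, rfl⟩

theorem DFun.projSnd : DFun M fun e : X × Y => e.2 where
  graph.definable := by
    refine (Definable.ex 1 (Definable.ex 2 (Definable.ex 3 ((Definable.isOPair 0 3 2 ?_ ?_ ?_).and
      ((Definable.isOPair 3 1 2 ?_ ?_ ?_).and ((Coded.range_var X 1).and (Coded.range_var Y 2))))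
      fun x v y => ?_) fun x v y => ?_) fun x v y => ?_).congr (P := fun v => ∃ a b w,
        IsOPair (v 0) w b ∧ IsOPair w a b ∧ (∃ x : X, code x = a) ∧ ∃ y : Y, code y = b)
        fun v => ?_
    any_goals omega
    any_goals (simp; done)
    simp only [isOPair_iff, Prod.exists, code_prod]
    constructor
    · rintro ⟨_, _, _, h, rfl, ⟨x, rfl⟩, y, rfl⟩
      exact ⟨x, y, y, h.symm, rfl⟩
    · rintro ⟨x, y, _, h, rfl⟩
      exact ⟨_, _, _, h.symm, rfl, ⟨x, rfl⟩, y, rfl⟩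

theorem DFun.comp (g : Y → Z) (f : X → Y) [hg : DFun M g] [hf : DFun M f] :
    DFun M fun x => g (f x) where
  graph.definable := by
    refine (Definable.ex 1 (Definable.ex 2 (Definable.ex 3 (Definable.ex 4 (Definable.ex 5
      ((Definable.isOPair 0 1 3 ?_ ?_ ?_).and
      ((Definable.isOPair 4 1 2 ?_ ?_ ?_).and ((Definable.isOPair 5 2 3 ?_ ?_ ?_).and
        ((hf.var 4).and (hg.var 5)))))
      fun x v y => ?_) fun x v y => ?_) fun x v y => ?_) fun x v y => ?_) fun x v y => ?_).congr
        (P := fun v => ∃ a b c p q,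
        IsOPair (v 0) a c ∧ IsOPair p a b ∧ IsOPair q b c ∧
          (∃ e : X × Y, code e = p ∧ f e.1 = e.2) ∧ ∃ e : Y × Z, code e = q ∧ g e.1 = e.2)
        fun v => ?_
    any_goals omega
    any_goals (simp; done)
    simp only [isOPair_iff, Prod.exists, code_prod]
    constructor
    · rintro ⟨_, _, _, _, _, h, rfl, rfl, ⟨x, y, h1, rfl⟩, y', z, h2, rfl⟩
      obtain ⟨rfl, rfl⟩ := opair_inj.1 h1
      obtain ⟨h3, rfl⟩ := opair_inj.1 h2
      obtain rfl := Coded.code_injective h3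
      exact ⟨x, _, h.symm, rfl⟩
    · rintro ⟨x, z, h, rfl⟩
      exact ⟨_, _, _, _, _, h.symm, rfl, rfl, ⟨x, _, rfl, rfl⟩, _, _, rfl, rfl⟩

theorem DFun.prodMk (f : X → Y) (g : X → Z) [hf : DFun M f] [hg : DFun M g] :
    DFun M fun x => (f x, g x) where
  graph.definable := by
    refine (Definable.ex 1 (Definable.ex 2 (Definable.ex 3 (Definable.ex 4 (Definable.ex 5
      (Definable.ex 6 ((Definable.isOPair 0 1 6 ?_ ?_ ?_).and ((Definable.isOPair 6 2 3 ?_ ?_ ?_).and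
      ((Definable.isOPair 4 1 2 ?_ ?_ ?_).and ((Definable.isOPair 5 1 3 ?_ ?_ ?_).and
        ((hf.var 4).and (hg.var 5)))))) fun x v y => ?_)
      fun x v y => ?_) fun x v y => ?_) fun x v y => ?_) fun x v y => ?_) fun x v y => ?_).congr
        (P := fun v => ∃ a b c p q w,
        IsOPair (v 0) a w ∧ IsOPair w b c ∧ IsOPair p a b ∧ IsOPair q a c ∧
          (∃ e : X × Y, code e = p ∧ f e.1 = e.2) ∧ ∃ e : X × Z, code e = q ∧ g e.1 = e.2)
        fun v => ?_
    any_goals omega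
    any_goals (simp; done)
    simp only [isOPair_iff, Prod.exists, code_prod]
    constructor
    · rintro ⟨_, _, _, _, _, _, h, rfl, rfl, rfl, ⟨x, y, h1, rfl⟩, x', z, h2, rfl⟩
      obtain ⟨rfl, rfl⟩ := opair_inj.1 h1
      obtain ⟨h3, rfl⟩ := opair_inj.1 h2
      obtain rfl := Coded.code_injective h3
      exact ⟨x', _, _, h.symm, rfl⟩
    · rintro ⟨x, y, z, h, hyz⟩
      obtain ⟨rfl, rfl⟩ := Prod.mk.inj hyz
      exact ⟨_, _, _, _, _, _, h.symm, rfl, rfl, rfl, ⟨x, _, rfl, rfl⟩, x, _, rfl, rfl⟩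

instance DFun.const (c : Y) : DFun M fun _ : X => c where
  graph := by
    have : Dfn M fun y : Y => c = y :=
      ⟨(Definable.eq_param 0 (code c)).congr fun v => by simp [eq_comm]⟩
    have := DFun.projSnd (M := M) (X := X) (Y := Y)
    exact Dfn.comp ‹Dfn M fun y : Y => c = y› fun e : X × Y => e.2

instance DFun.fst (f : X → Y × Z) [DFun M f] : DFun M fun x => (f x).1 :=
  have := DFun.projFst (M := M) (X := Y) (Y := Z)
  DFun.comp (fun e : Y × Z => e.1) f

instance DFun.snd (f : X → Y × Z) [DFun M f] : DFun M fun x => (f x).2 :=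
  have := DFun.projSnd (M := M) (X := Y) (Y := Z)
  DFun.comp (fun e : Y × Z => e.2) f

theorem Dfn.comp₂ {P : Y → Z → Prop} (h : Dfn M fun e : Y × Z => P e.1 e.2) (f : X → Y)
    (g : X → Z) [DFun M f] [DFun M g] : Dfn M fun x => P (f x) (g x) :=
  have := DFun.prodMk (M := M) f g
  Dfn.comp h fun x => (f x, g x)

theorem DFun.comp₂ {W : Type u} [Coded M W] {h : Y → Z → W} (_ : DFun M fun e : Y × Z => h e.1 e.2)
    (f : X → Y) (g : X → Z) [DFun M f] [DFun M g] : DFun M fun x => h (f x) (g x) :=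
  have := DFun.prodMk (M := M) f g
  DFun.comp (fun e : Y × Z => h e.1 e.2) fun x => (f x, g x)

instance Dfn.eq (f g : X → Y) [DFun M f] [DFun M g] : Dfn M fun x => f x = g x :=
  Dfn.comp₂ (P := fun a b => a = b) (DFun.id (M := M)).graph f g

instance Dfn.eq_self (c : X) : Dfn M (Eq c) := Dfn.eq (fun _ => c) fun x => x

theorem Dfn.memProj : Dfn M fun e : M × M => e.1 ∈ₘ e.2 where
  definable := by
    refine (Definable.ex 1 (Definable.ex 2 ((Definable.isOPair 0 1 2 ?_ ?_ ?_).and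
      (Definable.mem 1 2)) fun x v y => ?_) fun x v y => ?_).congr
        (P := fun v => ∃ a b, IsOPair (v 0) a b ∧ a ∈ₘ b) fun v => ?_
    any_goals omega
    any_goals (simp; done)
    simp only [isOPair_iff, Prod.exists, code_prod]
    constructor
    · rintro ⟨a, b, h, hm⟩
      exact ⟨a, b, h.symm, hm⟩
    · rintro ⟨a, b, h, hm⟩
      exact ⟨a, b, h.symm, hm⟩

instance Dfn.mem (f g : X → M) [DFun M f] [DFun M g] : Dfn M fun x => f x ∈ₘ g x :=
  Dfn.comp₂ Dfn.memProj f g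

theorem DFun.of_iff {f : X → Y} {P : X → Y → Prop} (h : Dfn M fun e : X × Y => P e.1 e.2)
    (e : ∀ x y, f x = y ↔ P x y) : DFun M f :=
  ⟨h.congr fun _ => (e _ _).symm⟩

instance DFun.ite (P : X → Prop) [∀ x, Decidable (P x)] (f g : X → Y) [Dfn M P] [DFun M f]
    [DFun M g] : DFun M fun x => if P x then f x else g x := by
  -- Under quantifiers the variable `x` turns into a projection `t e` from a larger product, so
  -- instance search needs definability after every substitution `t`. The same kind of local
  -- hypothesis recurs throughout.
  have hP : ∀ {E : Type u} [Coded M E] (t : E → X) [DFun M t], Dfn M fun e => P (t e) :=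
    fun t => Dfn.comp ‹_› t
  have hf : ∀ {E : Type u} [Coded M E] (t : E → X) [DFun M t], DFun M fun e => f (t e) :=
    fun t => DFun.comp f t
  have hg : ∀ {E : Type u} [Coded M E] (t : E → X) [DFun M t], DFun M fun e => g (t e) :=
    fun t => DFun.comp g t
  refine DFun.of_iff (P := fun x y => (P x ∧ f x = y) ∨ (¬ P x ∧ g x = y)) inferInstance
    fun x y => ?_
  split_ifs with h <;> simp [h]

/-! ### Comprehension -/

/-- A coded type whose elements form a set. -/
class Small (M : Type u) [SetStructure M] (X : Type u) [Coded M X] : Prop where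
  exists_bound : ∃ a : M, ∀ x : X, code x ∈ₘ a

/-- The source of new sets of the model: smallness places the definable class inside a set, and
separation cuts it out. -/
theorem comprehension [Small M X] (P : X → Prop) [h : Dfn M P] :
    ∃ s : M, ∀ z, z ∈ₘ s ↔ ∃ x, code x = z ∧ P x := by
  obtain ⟨a, ha⟩ := Small.exists_bound (M := M) (X := X)
  obtain ⟨c, hc⟩ := Definable.separation (P := fun m => ∃ x, code x = m ∧ P x) h.definable a
  refine ⟨c, fun z => (hc z).trans ⟨fun h => h.2, fun h => ⟨?_, h⟩⟩⟩
  obtain ⟨x, rfl, -⟩ := h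
  exact ha x

/-- Kuratowski pairs of elements of `d = a ∪ b` are sets of subsets of `d`, so they lie in the
second power set of `d`. -/
instance Small.prod [Small M X] [Small M Y] : Small M (X × Y) where
  exists_bound := by
    have hZ := ZFModel.zf (M := M)
    obtain ⟨a, ha⟩ := Small.exists_bound (M := M) (X := X)
    obtain ⟨b, hb⟩ := Small.exists_bound (M := M) (X := Y)
    obtain ⟨c, hc⟩ := hZ.pairing a b
    obtain ⟨d, hd⟩ := hZ.union c
    obtain ⟨e, he⟩ := hZ.powerset d
    obtain ⟨f, hf⟩ := hZ.powerset e
    have h1 : ∀ x : X, code x ∈ₘ d := fun x => (hd _).2 ⟨a, (hc a).2 (Or.inl rfl), ha x⟩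
    have h2 : ∀ y : Y, code y ∈ₘ d := fun y => (hd _).2 ⟨b, (hc b).2 (Or.inr rfl), hb y⟩
    refine ⟨f, fun p => (hf _).2 fun z hz => (he _).2 fun w hw => ?_⟩
    obtain ⟨s, t, hs, ht, hst⟩ := isOPair_opair (code p.1 : M) (code p.2)
    rcases (hst z).1 hz with rfl | rfl
    · rcases (hs w).1 hw with rfl | rfl <;> exact h1 _
    · rcases (ht w).1 hw with rfl | rfl
      · exact h1 _
      · exact h2 _

end Typed

/-! ### Definability of subtypes and of the basic set-theoretic predicates -/

section Instances

variable {M : Type u} [SetStructure M] [ZFModel M] {X Y : Type u} [Coded M X] [Coded M Y]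

/-- A definable subtype of a coded type is coded. -/
@[reducible]
def Coded.subtype (P : X → Prop) [h : Dfn M P] : Coded M {x // P x} where
  code x := code x.1
  code_injective _ _ h := Subtype.ext (Coded.code_injective h)
  definable_range := h.definable.congr fun v => by
    simp only [Subtype.exists, exists_prop]
    exact exists_congr fun x => and_comm

theorem DFun.subtypeVal (P : X → Prop) [h : Dfn M P] :
    letI := Coded.subtype (M := M) P
    DFun M fun x : {x // P x} => x.1 := by
  let _ := Coded.subtype (M := M) P
  have hP : Dfn M fun e : X × X => P e.1 := Dfn.comp h fun e : X × X => e.1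
  have : Dfn M fun e : X × X => P e.1 ∧ e.1 = e.2 := inferInstance
  refine ⟨⟨this.definable.congr fun v => ?_⟩⟩
  simp only [Prod.exists, code_prod, Subtype.exists]
  constructor
  · rintro ⟨a, b, h, ha, rfl⟩
    exact ⟨a, ha, a, h, rfl⟩
  · rintro ⟨a, ha, b, h, rfl⟩
    exact ⟨a, a, h, ha, rfl⟩

variable (f g h : X → M) [DFun M f] [DFun M g] [DFun M h]

instance Dfn.isVoid : Dfn M fun x => IsVoid (f x) := by
  have hf : ∀ {E : Type u} [Coded M E] (t : E → X) [DFun M t], DFun M fun e => f (t e) :=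
    fun t => DFun.comp f t
  unfold IsVoid; infer_instance

instance Dfn.isSucc : Dfn M fun x => IsSucc (f x) (g x) := by
  have hf : ∀ {E : Type u} [Coded M E] (t : E → X) [DFun M t], DFun M fun e => f (t e) :=
    fun t => DFun.comp f t
  have hg : ∀ {E : Type u} [Coded M E] (t : E → X) [DFun M t], DFun M fun e => g (t e) :=
    fun t => DFun.comp g t
  unfold IsSucc; infer_instance

instance Dfn.isPair : Dfn M fun x => IsPair (f x) (g x) (h x) := by
  have hf : ∀ {E : Type u} [Coded M E] (t : E → X) [DFun M t], DFun M fun e => f (t e) :=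
    fun t => DFun.comp f t
  have hg : ∀ {E : Type u} [Coded M E] (t : E → X) [DFun M t], DFun M fun e => g (t e) :=
    fun t => DFun.comp g t
  have hh : ∀ {E : Type u} [Coded M E] (t : E → X) [DFun M t], DFun M fun e => h (t e) :=
    fun t => DFun.comp h t
  unfold IsPair; infer_instance

instance Dfn.isOPair : Dfn M fun x => IsOPair (f x) (g x) (h x) := by
  have hf : ∀ {E : Type u} [Coded M E] (t : E → X) [DFun M t], DFun M fun e => f (t e) :=
    fun t => DFun.comp f t
  have hg : ∀ {E : Type u} [Coded M E] (t : E → X) [DFun M t], DFun M fun e => g (t e) :=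
    fun t => DFun.comp g t
  have hh : ∀ {E : Type u} [Coded M E] (t : E → X) [DFun M t], DFun M fun e => h (t e) :=
    fun t => DFun.comp h t
  unfold IsOPair; infer_instance

instance DFun.opair : DFun M fun x => opair (f x) (g x) := by
  have hf : ∀ {E : Type u} [Coded M E] (t : E → X) [DFun M t], DFun M fun e => f (t e) :=
    fun t => DFun.comp f t
  have hg : ∀ {E : Type u} [Coded M E] (t : E → X) [DFun M t], DFun M fun e => g (t e) :=
    fun t => DFun.comp g t
  exact DFun.of_iff (P := fun x y => IsOPair y (f x) (g x)) inferInstance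
    fun x y => by rw [isOPair_iff, eq_comm]

instance Dfn.rel : Dfn M fun x => Rel (f x) (g x) (h x) := by
  simp only [rel_iff]; infer_instance

instance Dfn.isInductive : Dfn M fun x => IsInductive (f x) := by
  have hf : ∀ {E : Type u} [Coded M E] (t : E → X) [DFun M t], DFun M fun e => f (t e) :=
    fun t => DFun.comp f t
  unfold IsInductive; infer_instance

instance Dfn.isNat : Dfn M fun x => IsNat (f x) := by
  have hf : ∀ {E : Type u} [Coded M E] (t : E → X) [DFun M t], DFun M fun e => f (t e) :=
    fun t => DFun.comp f t
  unfold IsNat; infer_instance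

instance Dfn.isNat_self : Dfn M (IsNat (M := M)) := Dfn.isNat fun x : M => x

instance Dfn.isBaire : Dfn M fun x => IsBaire (f x) := by
  have hf : ∀ {E : Type u} [Coded M E] (t : E → X) [DFun M t], DFun M fun e => f (t e) :=
    fun t => DFun.comp f t
  unfold IsBaire IsMap IsPartialMap IsRelation; infer_instance

instance Dfn.isBaire_self : Dfn M (IsBaire (M := M)) := Dfn.isBaire fun x : M => x

end Instances

/-! ### The natural numbers of the model -/

/-- The natural numbers of the model. -/
def Omega (M : Type u) [SetStructure M] : Type u := {n : M // IsNat n}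

namespace Omega

variable {M : Type u} [SetStructure M]

/-- The underlying set of a natural number of the model. -/
def val (n : Omega M) : M := n.1

theorem isNat (n : Omega M) : IsNat n.val := n.2

@[ext] theorem ext {m n : Omega M} (h : m.val = n.val) : m = n := Subtype.ext h

instance : LT (Omega M) := ⟨fun a b => a.val ∈ₘ b.val⟩

theorem lt_def {a b : Omega M} : a < b ↔ a.val ∈ₘ b.val := Iff.rfl

variable [ZFModel M]

instance : Coded M (Omega M) := Coded.subtype (IsNat (M := M))

section Typed

variable {X : Type u} [Coded M X]

instance dfun_val_self : DFun M fun n : Omega M => n.val :=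
  DFun.subtypeVal (M := M) (IsNat (M := M))

instance dfun_val (f : X → Omega M) [DFun M f] : DFun M fun x => (f x).val :=
  DFun.comp (fun n : Omega M => n.val) f

instance dfn_lt (f g : X → Omega M) [DFun M f] [DFun M g] : Dfn M fun x => f x < g x :=
  (inferInstance : Dfn M fun x => (f x).val ∈ₘ (g x).val)

instance dfn_lt_self (c : Omega M) : Dfn M (c < ·) := dfn_lt (fun _ => c) fun x => x

end Typed

theorem exists_void : ∃ e : M, IsVoid e := by
  obtain ⟨w, ⟨e, he, -⟩, -⟩ := (ZFModel.zf (M := M)).infinity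
  exact ⟨e, he⟩

theorem _root_.WeihrauchAD.IsVoid.unique {e e' : M} (h : IsVoid e) (h' : IsVoid e') : e = e' :=
  set_ext fun x => iff_of_false (h x) (h' x)

theorem exists_isSucc (n : M) : ∃ s, IsSucc s n := by
  have hZ := ZFModel.zf (M := M)
  obtain ⟨a, ha⟩ := hZ.pairing n n
  obtain ⟨b, hb⟩ := hZ.pairing n a
  obtain ⟨c, hc⟩ := hZ.union b
  refine ⟨c, fun x => (hc x).trans ⟨?_, ?_⟩⟩
  · rintro ⟨y, hy, hx⟩
    rcases (hb y).1 hy with rfl | rfl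
    · exact Or.inl hx
    · exact Or.inr (by simpa using (ha x).1 hx)
  · rintro (h | rfl)
    · exact ⟨n, (hb n).2 (Or.inl rfl), h⟩
    · exact ⟨a, (hb a).2 (Or.inr rfl), (ha x).2 (Or.inl rfl)⟩

theorem _root_.WeihrauchAD.IsSucc.unique {s s' n : M} (h : IsSucc s n) (h' : IsSucc s' n) :
    s = s' :=
  set_ext fun x => (h x).trans (h' x).symm

theorem isNat_void {e : M} (he : IsVoid e) : IsNat e := by
  rintro w ⟨⟨e', he', hw⟩, -⟩
  rwa [he.unique he']

theorem isNat_succ {s n : M} (hn : IsNat n) (hs : IsSucc s n) : IsNat s := by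
  intro w hw
  obtain ⟨s', hs', h⟩ := hw.2 n (hn w hw)
  rwa [hs.unique hs']

noncomputable instance : Zero (Omega M) := ⟨⟨exists_void.choose, isNat_void exists_void.choose_spec⟩⟩

theorem isVoid_zero : IsVoid (0 : Omega M).val := exists_void.choose_spec

theorem isVoid_iff {e : M} : IsVoid e ↔ e = (0 : Omega M).val :=
  ⟨fun h => h.unique isVoid_zero, fun h => h ▸ isVoid_zero⟩

/-- The successor of a natural number of the model. -/
noncomputable def succ (n : Omega M) : Omega M :=
  ⟨(exists_isSucc n.val).choose, isNat_succ n.isNat (exists_isSucc n.val).choose_spec⟩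

theorem isSucc_succ (n : Omega M) : IsSucc n.succ.val n.val := (exists_isSucc n.val).choose_spec

theorem isSucc_iff {s : M} {n : Omega M} : IsSucc s n.val ↔ s = n.succ.val :=
  ⟨fun h => h.unique (isSucc_succ n), fun h => h ▸ isSucc_succ n⟩

instance dfun_succ {X : Type u} [Coded M X] (f : X → Omega M) [DFun M f] :
    DFun M fun x => (f x).succ := by
  have hf : ∀ {E : Type u} [Coded M E] (t : E → X) [DFun M t], DFun M fun e => f (t e) :=
    fun t => DFun.comp f t
  exact DFun.of_iff (P := fun x y => IsSucc y.val (f x).val) inferInstance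
    fun x y => by rw [isSucc_iff, eq_comm, Omega.ext_iff]

instance dfun_succ_self : DFun M (succ (M := M)) := dfun_succ fun x => x

instance small : Small M (Omega M) where
  exists_bound := by
    obtain ⟨w, hw⟩ := (ZFModel.zf (M := M)).infinity
    exact ⟨w, fun n => n.isNat w hw⟩

/-- Induction for definable predicates. -/
theorem induction {P : Omega M → Prop} (hP : Dfn M P) (h0 : P 0) (hs : ∀ n, P n → P n.succ)
    (n : Omega M) : P n := by
  obtain ⟨s, hs'⟩ := comprehension (M := M) P
  have : IsInductive s := by
    refine ⟨⟨_, isVoid_zero, (hs' _).2 ⟨0, rfl, h0⟩⟩, fun x hx => ?_⟩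
    obtain ⟨m, rfl, hm⟩ := (hs' x).1 hx
    exact ⟨_, isSucc_succ m, (hs' _).2 ⟨m.succ, rfl, hs m hm⟩⟩
  obtain ⟨m, hm, hPm⟩ := (hs' _).1 (n.isNat s this)
  rwa [← show m = n from Omega.ext hm]

theorem not_lt_zero' (n : Omega M) : ¬ n < 0 := isVoid_zero _

theorem lt_succ_iff_lt_or_eq {a b : Omega M} : a < b.succ ↔ a < b ∨ a = b := by
  rw [lt_def, isSucc_succ b a.val, lt_def, Omega.ext_iff]

theorem lt_succ_self (n : Omega M) : n < n.succ := lt_succ_iff_lt_or_eq.2 (Or.inr rfl)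

/-- Transitivity of `ω`: it makes the membership order on a number an order on numbers, so that
restrictions have natural arguments. -/
theorem isNat_of_mem {x : M} {n : Omega M} : x ∈ₘ n.val → IsNat x := by
  refine induction (P := fun n : Omega M => ∀ x : M, x ∈ₘ n.val → IsNat x) inferInstance
    (fun x hx => (isVoid_zero x hx).elim) (fun n ih x hx => ?_) n x
  rcases (isSucc_succ n x).1 hx with h | rfl
  · exact ih x h
  · exact n.isNat

theorem lt_trans' {a b c : Omega M} : a < b → b < c → a < c := by
  refine induction (P := fun c : Omega M => ∀ a b : Omega M, a < b → b < c → a < c) inferInstance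
    (fun a b _ h => (not_lt_zero' b h).elim) (fun c ih a b hab hbc => ?_) c a b
  rcases lt_succ_iff_lt_or_eq.1 hbc with h | rfl
  · exact lt_succ_iff_lt_or_eq.2 (Or.inl (ih a b hab h))
  · exact lt_succ_iff_lt_or_eq.2 (Or.inl hab)

theorem lt_irrefl' (a : Omega M) : ¬ a < a := by
  refine induction (P := fun a : Omega M => ¬ a < a) inferInstance (not_lt_zero' 0)
    (fun n ih h => ?_) a
  rcases lt_succ_iff_lt_or_eq.1 h with h' | h'
  · exact ih (lt_trans' (lt_succ_self n) h')
  · have := lt_succ_self n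
    rw [h'] at this
    exact ih (h' ▸ this)

theorem zero_eq_or_lt (n : Omega M) : 0 = n ∨ 0 < n := by
  refine induction (P := fun n : Omega M => 0 = n ∨ 0 < n) inferInstance (Or.inl rfl)
    (fun n ih => Or.inr ?_) n
  rcases ih with rfl | h
  · exact lt_succ_self _
  · exact lt_trans' h (lt_succ_self n)

theorem succ_lt_or_eq {a b : Omega M} : a < b → a.succ < b ∨ a.succ = b := by
  refine induction (P := fun b : Omega M => ∀ a : Omega M, a < b → a.succ < b ∨ a.succ = b)
    inferInstance (fun a h => (not_lt_zero' a h).elim) (fun b ih a h => ?_) b a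
  rcases lt_succ_iff_lt_or_eq.1 h with h | rfl
  · rcases ih a h with h | h
    · exact Or.inl (lt_trans' h (lt_succ_self b))
    · exact Or.inl (h ▸ lt_succ_self b)
  · exact Or.inr rfl

theorem lt_trichotomy' (a b : Omega M) : a < b ∨ a = b ∨ b < a := by
  refine induction (P := fun a : Omega M => ∀ b : Omega M, a < b ∨ a = b ∨ b < a)
    inferInstance (fun b => ?_) (fun a ih b => ?_) a b
  · rcases zero_eq_or_lt b with h | h
    · exact Or.inr (Or.inl h)
    · exact Or.inl h
  · rcases ih b with h | rfl | h
    · rcases succ_lt_or_eq h with h | h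
      · exact Or.inl h
      · exact Or.inr (Or.inl h)
    · exact Or.inr (Or.inr (lt_succ_self _))
    · exact Or.inr (Or.inr (lt_trans' h (lt_succ_self a)))

noncomputable instance : LinearOrder (Omega M) where
  le a b := a < b ∨ a = b
  lt a b := a < b
  le_refl a := Or.inr rfl
  le_trans a b c := by
    rintro (h | rfl) (h' | rfl)
    · exact Or.inl (lt_trans' h h')
    · exact Or.inl h
    · exact Or.inl h'
    · exact Or.inr rfl
  lt_iff_le_not_ge a b := by
    constructor
    · refine fun h => ⟨Or.inl h, ?_⟩
      rintro (h' | rfl)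
      · exact lt_irrefl' _ (lt_trans' h h')
      · exact lt_irrefl' _ h
    · rintro ⟨h | rfl, h'⟩
      · exact h
      · exact (h' (Or.inr rfl)).elim
  le_antisymm a b := by
    rintro (h | rfl) (h' | h')
    · exact (lt_irrefl' _ (lt_trans' h h')).elim
    · exact h'.symm
    · rfl
    · rfl
  le_total a b := by
    rcases lt_trichotomy' a b with h | rfl | h
    · exact Or.inl (Or.inl h)
    · exact Or.inl (Or.inr rfl)
    · exact Or.inr (Or.inl h)
  toDecidableLE := Classical.decRel _

instance dfn_le {X : Type u} [Coded M X] (f g : X → Omega M) [DFun M f] [DFun M g] :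
    Dfn M fun x => f x ≤ g x :=
  (inferInstance : Dfn M fun x => f x < g x ∨ f x = g x)

instance dfn_lt' {X : Type u} [Coded M X] (f g : X → Omega M) [DFun M f] [DFun M g] :
    Dfn M fun x => f x < g x :=
  dfn_lt f g

theorem lt_succ_iff {a b : Omega M} : a < b.succ ↔ a ≤ b := lt_succ_iff_lt_or_eq

theorem zero_le (n : Omega M) : 0 ≤ n := (zero_eq_or_lt n).symm.imp_right id

theorem not_lt_zero (n : Omega M) : ¬ n < 0 := not_lt_zero' n

theorem le_succ (n : Omega M) : n ≤ n.succ := (lt_succ_self n).le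

theorem succ_le_iff {a b : Omega M} : a.succ ≤ b ↔ a < b :=
  ⟨fun h => (lt_succ_self a).trans_le h, succ_lt_or_eq⟩

theorem succ_injective : Function.Injective (succ (M := M)) := fun a b h =>
  le_antisymm (lt_succ_iff.1 (h ▸ lt_succ_self a)) (lt_succ_iff.1 (h ▸ lt_succ_self b))

theorem succ_inj {a b : Omega M} : a.succ = b.succ ↔ a = b := succ_injective.eq_iff

theorem succ_ne_zero (n : Omega M) : n.succ ≠ 0 := fun h => not_lt_zero n (h ▸ lt_succ_self n)

theorem eq_zero_or_succ (n : Omega M) : n = 0 ∨ ∃ m : Omega M, n = m.succ := by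
  refine induction (P := fun n : Omega M => n = 0 ∨ ∃ m : Omega M, n = m.succ) inferInstance
    (Or.inl rfl) (fun n _ => Or.inr ⟨n, rfl⟩) n

theorem exists_least {P : Omega M → Prop} (hP : Dfn M P) (h : ∃ n, P n) :
    ∃ n, P n ∧ ∀ k, k < n → ¬ P k := by
  have hP' : ∀ {E : Type u} [Coded M E] (t : E → Omega M) [DFun M t], Dfn M fun e => P (t e) :=
    fun t => Dfn.comp hP t
  by_contra hc
  push Not at hc
  have : ∀ n : Omega M, ∀ k : Omega M, k < n → ¬ P k := by
    refine induction (P := fun n : Omega M => ∀ k : Omega M, k < n → ¬ P k) inferInstance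
      (fun k h => (not_lt_zero k h).elim) fun n ih k hk hPk => ?_
    obtain ⟨j, hj, hPj⟩ := hc k hPk
    exact ih j (hj.trans_le (lt_succ_iff.1 hk)) hPj
  obtain ⟨n, hn⟩ := h
  exact this n.succ n (lt_succ_self n) hn

open Classical in
/-- The least number with the property `P`, or `0` if there is none. -/
noncomputable def mu (P : Omega M → Prop) : Omega M :=
  if h : ∃ n, P n ∧ ∀ k, k < n → ¬ P k then h.choose else 0

/-- `mu` distinguishes whether a least witness exists, not merely a witness. The description of its
graph therefore holds for arbitrary `P`, and it is first-order in `P`, which yields `dfun_mu`. -/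
theorem mu_eq_iff {P : Omega M → Prop} {n : Omega M} : mu P = n ↔
    (P n ∧ ∀ k, k < n → ¬ P k) ∨ ((¬ ∃ n, P n ∧ ∀ k, k < n → ¬ P k) ∧ n = 0) := by
  unfold mu
  split_ifs with h
  · constructor
    · rintro rfl
      exact Or.inl h.choose_spec
    · rintro (⟨h1, h2⟩ | h')
      · rcases lt_trichotomy h.choose n with hl | hl | hl
        · exact (h2 _ hl h.choose_spec.1).elim
        · exact hl
        · exact (h.choose_spec.2 _ hl h1).elim
      · exact (h'.1 h).elim
  · constructor
    · rintro rfl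
      exact Or.inr ⟨h, rfl⟩
    · rintro (h' | h')
      · exact (h ⟨n, h'⟩).elim
      · exact h'.2.symm

theorem mu_spec {P : Omega M → Prop} (hP : Dfn M P) (h : ∃ n, P n) :
    P (mu P) ∧ ∀ k, k < mu P → ¬ P k := by
  rcases mu_eq_iff.1 (rfl : mu P = mu P) with h' | h'
  · exact h'
  · exact (h'.1 (exists_least hP h)).elim

theorem mu_eq {P : Omega M → Prop} {n : Omega M} (h : P n) (h' : ∀ k, k < n → ¬ P k) : mu P = n :=
  mu_eq_iff.2 (Or.inl ⟨h, h'⟩)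

theorem mu_eq_of_unique {P : Omega M → Prop} {n : Omega M} (h : P n) (h' : ∀ k, P k → k = n) :
    mu P = n :=
  mu_eq h fun k hk hP => hk.ne (h' k hP)

instance dfun_mu {X : Type u} [Coded M X] (P : X → Omega M → Prop)
    [h : Dfn M fun e : X × Omega M => P e.1 e.2] : DFun M fun x => mu (P x) := by
  have hP : ∀ {E : Type u} [Coded M E] (t : E → X) (s : E → Omega M) [DFun M t] [DFun M s],
    Dfn M fun e => P (t e) (s e) := fun t s => Dfn.comp₂ h t s
  exact DFun.of_iff (P := fun x n => (P x n ∧ ∀ k, k < n → ¬ P x k) ∨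
    ((¬ ∃ n, P x n ∧ ∀ k, k < n → ¬ P x k) ∧ n = 0)) inferInstance fun x n => mu_eq_iff

end Omega

/-! ### Baire space of the model -/

/-- The points of the Baire space of the model. -/
def Baire (M : Type u) [SetStructure M] : Type u := {p : M // IsBaire p}

section BaireSpace

variable {M : Type u} [SetStructure M] [ZFModel M]

theorem rel_isNat {p a b : M} (hp : IsBaire p) (h : Rel p a b) : IsNat a ∧ IsNat b := by
  obtain ⟨z, hz, hm⟩ := h
  obtain ⟨a', b', ha, hb, h⟩ := hp.1.1 z hm
  rw [isOPair_iff] at hz h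
  obtain ⟨rfl, rfl⟩ := opair_inj.1 (hz.symm.trans h)
  exact ⟨ha, hb⟩

namespace Baire

/-- The underlying set of a point of Baire space. -/
def val (p : Baire M) : M := p.1

omit [ZFModel M] in
theorem isBaire (p : Baire M) : IsBaire p.val := p.2

theorem exists_app (p : Baire M) (n : Omega M) : ∃ m : Omega M, Rel p.val n.val m.val := by
  obtain ⟨b, hb⟩ := p.isBaire.2 n.val n.isNat
  exact ⟨⟨b, (rel_isNat p.isBaire hb).2⟩, hb⟩

/-- The value of a point of Baire space at a natural number. -/
noncomputable def app (p : Baire M) (n : Omega M) : Omega M := (exists_app p n).choose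

noncomputable instance : CoeFun (Baire M) fun _ => Omega M → Omega M := ⟨app⟩

theorem rel_app (p : Baire M) (n : Omega M) : Rel p.val n.val (p n).val := (exists_app p n).choose_spec

theorem rel_iff {p : Baire M} {n m : Omega M} : Rel p.val n.val m.val ↔ p n = m :=
  ⟨fun h => Omega.ext (p.isBaire.1.2 _ _ _ (rel_app p n) h), fun h => h ▸ rel_app p n⟩

noncomputable instance : Coded M (Baire M) := Coded.subtype (IsBaire (M := M))

section Typed

variable {X : Type u} [Coded M X]

instance dfun_val_self : DFun M fun p : Baire M => p.val :=
  DFun.subtypeVal (M := M) (IsBaire (M := M))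

instance dfun_val (f : X → Baire M) [DFun M f] : DFun M fun x => (f x).val :=
  DFun.comp (fun p : Baire M => p.val) f

instance dfun_app (f : X → Baire M) (g : X → Omega M) [DFun M f] [DFun M g] :
    DFun M fun x => f x (g x) := by
  have hf : ∀ {E : Type u} [Coded M E] (t : E → X) [DFun M t], DFun M fun e => f (t e) :=
    fun t => DFun.comp f t
  have hg : ∀ {E : Type u} [Coded M E] (t : E → X) [DFun M t], DFun M fun e => g (t e) :=
    fun t => DFun.comp g t
  exact DFun.of_iff (P := fun x y => Rel (f x).val (g x).val y.val) inferInstance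
    fun x y => rel_iff.symm

instance dfun_app_self (p : Baire M) : DFun M (app p) := dfun_app (fun _ => p) fun n => n

end Typed

omit [ZFModel M] in
theorem eq_of_val {p q : Baire M} (h : p.val = q.val) : p = q := Subtype.ext h

@[ext] theorem ext {p q : Baire M} (h : ∀ n, p n = q n) : p = q := by
  have key : ∀ {p q : Baire M}, (∀ n, p n = q n) → ∀ z, z ∈ₘ p.val → z ∈ₘ q.val := by
    intro p q h z hz
    obtain ⟨a, b, ha, hb, hab⟩ := p.isBaire.1.1 z hz
    have : p ⟨a, ha⟩ = ⟨b, hb⟩ := rel_iff.1 ⟨z, hab, hz⟩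
    obtain ⟨z', hz', hm⟩ := rel_iff.2 ((h _).symm.trans this)
    rw [isOPair_iff] at hab hz'
    rw [hab]
    exact hz' ▸ hm
  exact eq_of_val (set_ext fun z => ⟨key h z, key (fun n => (h n).symm) z⟩)

/-- An arbitrary ambient function on `Omega M` need not be a set of the model; the graph of a
definable one is, by comprehension. -/
theorem exists_of_dfun (F : Omega M → Omega M) [hF : DFun M F] : ∃ p : Baire M, ∀ n, p n = F n := by
  have := hF.graph
  obtain ⟨s, hs⟩ := comprehension (M := M) fun e : Omega M × Omega M => F e.1 = e.2
  have hrel : ∀ n m : M, Rel s n m ↔ ∃ a : Omega M, a.val = n ∧ (F a).val = m := by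
    intro n m
    rw [WeihrauchAD.rel_iff, hs]
    constructor
    · rintro ⟨⟨a, b⟩, h, hF⟩
      obtain ⟨rfl, rfl⟩ := opair_inj.1 h
      exact ⟨a, rfl, congrArg Omega.val hF⟩
    · rintro ⟨a, rfl, rfl⟩
      exact ⟨(a, F a), rfl, rfl⟩
  have hB : IsBaire s := by
    refine ⟨⟨fun z hz => ?_, fun a b b' h h' => ?_⟩, fun a ha => ?_⟩
    · obtain ⟨e, rfl, -⟩ := (hs z).1 hz
      exact ⟨_, _, e.1.isNat, e.2.isNat, isOPair_opair _ _⟩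
    · obtain ⟨n, rfl, rfl⟩ := (hrel _ _).1 h
      obtain ⟨n', h1, rfl⟩ := (hrel _ _).1 h'
      rw [Omega.ext h1]
    · exact ⟨(F ⟨a, ha⟩).val, (hrel _ _).2 ⟨⟨a, ha⟩, rfl, rfl⟩⟩
  refine ⟨⟨s, hB⟩, fun n => rel_iff.1 ?_⟩
  exact (hrel _ _).2 ⟨n, rfl, rfl⟩

noncomputable instance : Inhabited (Baire M) := ⟨(exists_of_dfun fun _ : Omega M => 0).choose⟩

open Classical in
/-- The point of Baire space with given values. -/
noncomputable def lam (F : Omega M → Omega M) : Baire M :=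
  if h : ∃ p : Baire M, ∀ n, p n = F n then h.choose else default

theorem lam_app (F : Omega M → Omega M) [DFun M F] (n : Omega M) : lam F n = F n := by
  unfold lam
  rw [dif_pos (exists_of_dfun F)]
  exact (exists_of_dfun F).choose_spec n

instance dfun_lam {X : Type u} [Coded M X] (F : X → Omega M → Omega M)
    [h : DFun M fun e : X × Omega M => F e.1 e.2] : DFun M fun x => lam (F x) := by
  have hF : ∀ {E : Type u} [Coded M E] (t : E → X) (s : E → Omega M) [DFun M t] [DFun M s],
    DFun M fun e => F (t e) (s e) := fun t s => DFun.comp₂ h t s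
  have hF' : ∀ x, DFun M (F x) := fun x => hF (fun _ => x) fun n => n
  refine DFun.of_iff (P := fun x q => ∀ n, F x n = q n) inferInstance fun x q => ?_
  constructor
  · rintro rfl n
    exact (lam_app (F x) n).symm
  · exact fun h => ext fun n => (lam_app (F x) n).trans (h n)

/-- The constant sequences. -/
noncomputable def const (n : Omega M) : Baire M := lam fun _ => n

theorem const_app (n k : Omega M) : const n k = n := lam_app _ k

instance dfun_const {X : Type u} [Coded M X] (f : X → Omega M) [DFun M f] :
    DFun M fun x => const (f x) := by
  have hf : ∀ {E : Type u} [Coded M E] (t : E → X) [DFun M t], DFun M fun e => f (t e) :=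
    fun t => DFun.comp f t
  unfold const
  infer_instance

instance small : Small M (Baire M) where
  exists_bound := by
    obtain ⟨s, hs⟩ := comprehension (M := M) fun _ : Omega M × Omega M => True
    obtain ⟨P, hP⟩ := (ZFModel.zf (M := M)).powerset s
    refine ⟨P, fun p => (hP _).2 fun z hz => (hs z).2 ?_⟩
    obtain ⟨a, b, ha, hb, hab⟩ := p.isBaire.1.1 z hz
    exact ⟨(⟨a, ha⟩, ⟨b, hb⟩), (isOPair_iff.1 hab).symm, trivial⟩

end Baire

open Baire

/-! ### Recursion, pairing and codes of finite sequences -/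

/-- Definable recursion. -/
theorem exists_rec (x₀ : Omega M) (F : Omega M → Omega M → Omega M)
    (h : DFun M fun e : Omega M × Omega M => F e.1 e.2) :
    ∃ p : Baire M, p 0 = x₀ ∧ ∀ n, p n.succ = F n (p n) := by
  have hF : ∀ {E : Type u} [Coded M E] (t : E → Omega M) (s : E → Omega M) [DFun M t] [DFun M s],
    DFun M fun e => F (t e) (s e) := fun t s => DFun.comp₂ h t s
  -- Approximations are total sequences obeying the recursion only below `n`, which avoids handling
  -- finite sequences.
  have ex : ∀ n : Omega M, ∃ p : Baire M, p 0 = x₀ ∧ ∀ k, k < n → p k.succ = F k (p k) := by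
    refine Omega.induction inferInstance ⟨const x₀, const_app _ _, fun k hk =>
      (Omega.not_lt_zero k hk).elim⟩ fun n ih => ?_
    obtain ⟨p, hp0, hp⟩ := ih
    classical
    refine ⟨lam fun k => if k = n.succ then F n (p n) else p k, ?_, fun k hk => ?_⟩
    · rw [lam_app, if_neg (Omega.succ_ne_zero n).symm, hp0]
    · rw [lam_app, lam_app, if_neg hk.ne]
      rcases (Omega.lt_succ_iff.1 hk).lt_or_eq with h | rfl
      · rw [if_neg (Omega.succ_injective.ne h.ne), hp k h]
      · rw [if_pos rfl]
  have uniq : ∀ (n : Omega M) (p q : Baire M), (p 0 = x₀ ∧ ∀ k, k < n → p k.succ = F k (p k)) →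
      (q 0 = x₀ ∧ ∀ k, k < n → q k.succ = F k (q k)) → ∀ k, k ≤ n → p k = q k := by
    intro n p q hp hq
    refine Omega.induction inferInstance (fun _ => hp.1.trans hq.1.symm) fun k ih hk => ?_
    have hk' := Omega.succ_le_iff.1 hk
    rw [hp.2 k hk', hq.2 k hk', ih hk'.le]
  have dR : Dfn M fun e : Omega M × Omega M => ∃ p : Baire M,
    (p 0 = x₀ ∧ ∀ k, k < e.1 → p k.succ = F k (p k)) ∧ p e.1 = e.2 := inferInstance
  let G : Omega M → Omega M := fun n => (ex n).choose n
  have hG : ∀ n (p : Baire M), (p 0 = x₀ ∧ ∀ k, k < n → p k.succ = F k (p k)) → G n = p n :=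
    fun n p hp => uniq n _ p (ex n).choose_spec hp n le_rfl
  -- The chosen approximations need not depend definably on `n`, but their values do: any
  -- approximation gives the same value at `n`.
  have dG : DFun M G := DFun.of_iff (P := fun n v => ∃ p : Baire M,
    (p 0 = x₀ ∧ ∀ k, k < n → p k.succ = F k (p k)) ∧ p n = v) dR fun n v =>
      ⟨fun h => ⟨_, (ex n).choose_spec, h⟩, fun ⟨p, hp, h⟩ => (hG n p hp).trans h⟩
  refine ⟨lam G, ?_, fun n => ?_⟩
  · obtain ⟨p, hp⟩ := ex 0
    rw [lam_app, hG 0 p hp, hp.1]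
  · obtain ⟨p, hp⟩ := ex n.succ
    rw [lam_app, lam_app, hG _ p hp, hG n p ⟨hp.1, fun k hk => hp.2 k (hk.trans n.lt_succ_self)⟩,
      hp.2 n n.lt_succ_self]

theorem rec_unique {F : Omega M → Omega M → Omega M} {p q : Baire M} (h0 : p 0 = q 0)
    (hp : ∀ n, p n.succ = F n (p n)) (hq : ∀ n, q n.succ = F n (q n)) : p = q := by
  refine Baire.ext (Omega.induction inferInstance h0 fun n ih => ?_)
  rw [hp, hq, ih]

variable (M) in
theorem exists_double : ∃ d : Baire M, d 0 = 0 ∧ ∀ n, d n.succ = (d n).succ.succ :=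
  exists_rec 0 (fun _ v => v.succ.succ) inferInstance

variable (M) in
/-- The function `n ↦ 2 n`. -/
noncomputable def double : Baire M := (exists_double M).choose

theorem double_zero : double M 0 = 0 := (exists_double M).choose_spec.1

theorem double_succ (n : Omega M) : double M n.succ = (double M n).succ.succ :=
  (exists_double M).choose_spec.2 n

theorem exists_pairRow (b : Omega M) :
    ∃ r : Baire M, r 0 = double M b ∧ ∀ n, r n.succ = (double M (r n)).succ :=
  exists_rec (double M b) (fun _ v => (double M v).succ) inferInstance

/-- The pairing function `(a, b) ↦ 2 ^ a * (2 * b + 1) - 1`. -/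
noncomputable def pair (a b : Omega M) : Omega M := (exists_pairRow b).choose a

theorem pair_zero (b : Omega M) : pair 0 b = double M b := (exists_pairRow b).choose_spec.1

theorem pair_succ (a b : Omega M) : pair a.succ b = (double M (pair a b)).succ :=
  (exists_pairRow b).choose_spec.2 a

/-- `pair` is defined by choosing a solution of a recursion for each `b`. As that solution is
unique, quantifying over all solutions gives a definable graph. -/
theorem pair_eq_iff (a b v : Omega M) : pair a b = v ↔ ∃ r : Baire M,
    (r 0 = double M b ∧ ∀ n, r n.succ = (double M (r n)).succ) ∧ r a = v := by
  refine ⟨fun h => ⟨_, (exists_pairRow b).choose_spec, h⟩, ?_⟩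
  rintro ⟨r, ⟨h0, hs⟩, rfl⟩
  rw [rec_unique (F := fun _ v => (double M v).succ) (h0.trans (pair_zero b).symm) hs
    (fun n => pair_succ n b)]
  rfl

instance dfun_pair {X : Type u} [Coded M X] (f g : X → Omega M) [hf : DFun M f] [hg : DFun M g] :
    DFun M fun x => pair (f x) (g x) := by
  refine DFun.comp₂ (h := pair) ?_ f g
  exact DFun.of_iff (P := fun e v => ∃ r : Baire M,
    (r 0 = double M e.2 ∧ ∀ n, r n.succ = (double M (r n)).succ) ∧ r e.1 = v) inferInstance
    fun e v => pair_eq_iff e.1 e.2 v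

instance dfun_pair_self (a : Omega M) : DFun M (pair a) := dfun_pair (fun _ => a) fun b => b

theorem double_ne_succ_double (a b : Omega M) : double M a ≠ (double M b).succ := by
  refine Omega.induction (P := fun a => ∀ b : Omega M, double M a ≠ (double M b).succ)
    inferInstance (fun b h => ?_) (fun a ih b h => ?_) a b
  · rw [double_zero] at h
    exact Omega.succ_ne_zero _ h.symm
  · rw [double_succ, Omega.succ_inj] at h
    rcases Omega.eq_zero_or_succ b with rfl | ⟨c, rfl⟩
    · rw [double_zero] at h
      exact Omega.succ_ne_zero _ h
    · rw [double_succ, Omega.succ_inj] at h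
      exact ih c h

theorem double_injective {a b : Omega M} : double M a = double M b → a = b := by
  refine Omega.induction (P := fun a => ∀ b : Omega M, double M a = double M b → a = b)
    inferInstance (fun b h => ?_) (fun a ih b h => ?_) a b
  · rcases Omega.eq_zero_or_succ b with rfl | ⟨c, rfl⟩
    · rfl
    · rw [double_zero, double_succ] at h
      exact (Omega.succ_ne_zero _ h.symm).elim
  · rcases Omega.eq_zero_or_succ b with rfl | ⟨c, rfl⟩
    · rw [double_zero, double_succ] at h
      exact (Omega.succ_ne_zero _ h).elim
    · rw [double_succ, double_succ, Omega.succ_inj, Omega.succ_inj] at h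
      rw [ih c h]

theorem pair_injective {a b a' b' : Omega M} : pair a b = pair a' b' → a = a' ∧ b = b' := by
  refine Omega.induction (P := fun a => ∀ b a' b' : Omega M, pair a b = pair a' b' →
    a = a' ∧ b = b') inferInstance (fun b a' b' h => ?_) (fun a ih b a' b' h => ?_) a b a' b'
  · rcases Omega.eq_zero_or_succ a' with rfl | ⟨c, rfl⟩
    · rw [pair_zero, pair_zero] at h
      exact ⟨rfl, double_injective h⟩
    · rw [pair_zero, pair_succ] at h
      exact (double_ne_succ_double _ _ h).elim
  · rcases Omega.eq_zero_or_succ a' with rfl | ⟨c, rfl⟩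
    · rw [pair_zero, pair_succ] at h
      exact (double_ne_succ_double _ _ h.symm).elim
    · rw [pair_succ, pair_succ, Omega.succ_inj] at h
      obtain ⟨rfl, rfl⟩ := ih b c b' (double_injective h)
      exact ⟨rfl, rfl⟩

theorem pair_inj {a b a' b' : Omega M} : pair a b = pair a' b' ↔ a = a' ∧ b = b' :=
  ⟨pair_injective, fun h => by rw [h.1, h.2]⟩

/-- The sequences `p` and `q` agree below `n`. -/
def AgreeBelow (n : Omega M) (p q : Baire M) : Prop := ∀ k, k < n → p k = q k

instance dfn_agreeBelow {X : Type u} [Coded M X] (t : X → Omega M) (f g : X → Baire M)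
    [DFun M t] [DFun M f] [DFun M g] : Dfn M fun x => AgreeBelow (t x) (f x) (g x) := by
  have ht : ∀ {E : Type u} [Coded M E] (s : E → X) [DFun M s], DFun M fun e => t (s e) :=
    fun s => DFun.comp t s
  have hf : ∀ {E : Type u} [Coded M E] (t : E → X) [DFun M t], DFun M fun e => f (t e) :=
    fun t => DFun.comp f t
  have hg : ∀ {E : Type u} [Coded M E] (t : E → X) [DFun M t], DFun M fun e => g (t e) :=
    fun t => DFun.comp g t
  unfold AgreeBelow
  infer_instance

theorem AgreeBelow.refl (n : Omega M) (p : Baire M) : AgreeBelow n p p := fun _ _ => rfl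

theorem AgreeBelow.symm {n : Omega M} {p q : Baire M} (h : AgreeBelow n p q) : AgreeBelow n q p :=
  fun k hk => (h k hk).symm

theorem AgreeBelow.trans {n : Omega M} {p q r : Baire M} (h : AgreeBelow n p q)
    (h' : AgreeBelow n q r) : AgreeBelow n p r :=
  fun k hk => (h k hk).trans (h' k hk)

theorem AgreeBelow.mono {m n : Omega M} {p q : Baire M} (h : AgreeBelow n p q) (hm : m ≤ n) :
    AgreeBelow m p q :=
  fun k hk => h k (hk.trans_le hm)

theorem exists_codes (q : Baire M) :
    ∃ r : Baire M, r 0 = 0 ∧ ∀ n, r n.succ = (pair (r n) (q n)).succ :=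
  exists_rec 0 (fun n v => (pair v (q n)).succ) inferInstance

/-- A code of the restriction of `q` to the numbers below `n`. -/
noncomputable def res (q : Baire M) (n : Omega M) : Omega M := (exists_codes q).choose n

theorem res_zero (q : Baire M) : res q 0 = 0 := (exists_codes q).choose_spec.1

theorem res_succ (q : Baire M) (n : Omega M) : res q n.succ = (pair (res q n) (q n)).succ :=
  (exists_codes q).choose_spec.2 n

instance dfun_res {X : Type u} [Coded M X] (f : X → Baire M) (g : X → Omega M) [hf : DFun M f]
    [hg : DFun M g] : DFun M fun x => res (f x) (g x) := by
  refine DFun.comp₂ (h := res) ?_ f g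
  refine DFun.of_iff (P := fun e v => ∃ r : Baire M,
    (r 0 = 0 ∧ ∀ n, r n.succ = (pair (r n) (e.1 n)).succ) ∧ r e.2 = v) inferInstance fun e v => ?_
  refine ⟨fun h => ⟨_, (exists_codes e.1).choose_spec, h⟩, ?_⟩
  rintro ⟨r, ⟨h0, hs⟩, rfl⟩
  rw [rec_unique (F := fun n v => (pair v (e.1 n)).succ) (h0.trans (res_zero e.1).symm) hs
    (fun n => res_succ e.1 n)]
  rfl

instance dfun_res_self (p : Baire M) : DFun M (res p) := dfun_res (fun _ => p) fun b => b

/-- The successor in the recursion for `res` keeps nonempty codes apart from the code `0` of the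
empty sequence, so length and entries can be recovered by peeling off the last entry. -/
theorem res_eq_iff {p q : Baire M} {m n : Omega M} :
    res p m = res q n ↔ m = n ∧ AgreeBelow m p q := by
  constructor
  · refine Omega.induction (P := fun m => ∀ n : Omega M, res p m = res q n →
      m = n ∧ AgreeBelow m p q) inferInstance (fun n h => ?_) (fun m ih n h => ?_) m n
    · rcases Omega.eq_zero_or_succ n with rfl | ⟨c, rfl⟩
      · exact ⟨rfl, fun k hk => (Omega.not_lt_zero k hk).elim⟩
      · rw [res_zero, res_succ] at h
        exact (Omega.succ_ne_zero _ h.symm).elim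
    · rcases Omega.eq_zero_or_succ n with rfl | ⟨c, rfl⟩
      · rw [res_zero, res_succ] at h
        exact (Omega.succ_ne_zero _ h).elim
      · rw [res_succ, res_succ, Omega.succ_inj, pair_inj] at h
        obtain ⟨h, h'⟩ := h
        obtain ⟨rfl, ha⟩ := ih c h
        refine ⟨rfl, fun k hk => ?_⟩
        rcases (Omega.lt_succ_iff.1 hk).lt_or_eq with hk | rfl
        · exact ha k hk
        · exact h'
  · rintro ⟨rfl, h⟩
    refine Omega.induction (P := fun m => AgreeBelow m p q → res p m = res q m) inferInstance
      (fun _ => by rw [res_zero, res_zero]) (fun m ih h => ?_) m h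
    rw [res_succ, res_succ, ih (h.mono m.le_succ), h m m.lt_succ_self]

end BaireSpace

open Baire

/-! ### Continuous reducibility in terms of definable functions -/

section Reductions

variable {M : Type u} [SetStructure M] [ZFModel M]

/-- A definable partial function becomes total by a default value, which is only one more parameter.
This turns the sets `H` and `K` of a reduction into functions. -/
theorem exists_dfun {X Y : Type u} [Coded M X] [Coded M Y] [Inhabited Y] {R : X → Y → Prop}
    (h : Dfn M fun e : X × Y => R e.1 e.2) (hu : ∀ x y y', R x y → R x y' → y = y') :
    ∃ f : X → Y, DFun M f ∧ ∀ x y, R x y → f x = y := by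
  classical
  have hR : ∀ {E : Type u} [Coded M E] (t : E → X) (s : E → Y) [DFun M t] [DFun M s],
    Dfn M fun e => R (t e) (s e) := fun t s => Dfn.comp₂ h t s
  let f : X → Y := fun x => if hx : ∃ y, R x y then hx.choose else default
  have hf : ∀ x y, R x y → f x = y := fun x y hxy => by
    have hx : ∃ y, R x y := ⟨y, hxy⟩
    simp only [f, dif_pos hx]
    exact hu _ _ _ hx.choose_spec hxy
  refine ⟨f, DFun.of_iff (P := fun x y => R x y ∨ (¬ ∃ y, R x y) ∧ default = y) inferInstance
    fun x y => ⟨?_, ?_⟩, hf⟩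
  · rintro rfl
    by_cases hx : ∃ y, R x y
    · obtain ⟨y, hy⟩ := hx
      exact Or.inl ((hf x y hy).symm ▸ hy)
    · exact Or.inr ⟨hx, by simp only [f, dif_neg hx]⟩
  · rintro (hy | ⟨hx, rfl⟩)
    · exact hf x y hy
    · simp only [f, dif_neg hx]

theorem agree_iff {n : Omega M} {p q : Baire M} :
    Agree n.val p.val q.val ↔ AgreeBelow n p q := by
  constructor
  · exact fun h k hk => (Baire.rel_iff.1 ((h k.val hk _).1 (rel_app p k))).symm
  · have key : ∀ {p q : Baire M}, AgreeBelow n p q → ∀ k, k ∈ₘ n.val → ∀ v,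
        Rel p.val k v → Rel q.val k v := by
      intro p q h k hk v hv
      obtain ⟨hk', hv'⟩ := rel_isNat p.isBaire hv
      have h1 : p ⟨k, hk'⟩ = ⟨v, hv'⟩ := Baire.rel_iff.1 hv
      exact Baire.rel_iff.2 ((h ⟨k, hk'⟩ hk).symm.trans h1)
    exact fun h k hk v => ⟨key h k hk v, key h.symm k hk v⟩

/-- Continuous reducibility of the problem `F` of finding a natural number to the
problem `G` of finding a point of Baire space. -/
def Red (F : Baire M → Omega M → Prop) (G : Baire M → Baire M → Prop) : Prop :=
  ∃ (H : Baire M → Baire M) (K : Baire M → Baire M → Omega M),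
    DFun M H ∧ DFun M (fun e : Baire M × Baire M => K e.1 e.2) ∧
    (∀ p, (∃ n, F p n) → ∀ n, ∃ m, ∀ p', (∃ n, F p' n) → AgreeBelow m p p' → H p n = H p' n) ∧
    (∀ p q, (∃ n, F p n) → G (H p) q → ∃ m, ∀ p' q', (∃ n, F p' n) → G (H p') q' →
      AgreeBelow m p p' → AgreeBelow m q q' → K p q = K p' q') ∧
    ∀ p, (∃ n, F p n) → (∃ q, G (H p) q) ∧ ∀ q, G (H p) q → F p (K p q)

/-- The first-order problem `F` on the level of names. -/
def onZero (F : Baire M → Omega M → Prop) (p q : Baire M) : Prop := F p (q 0)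

/-- `F'` is the problem of sets corresponding to the problem `F`. -/
def Presents (F' : M → M → Prop) (F : Baire M → Baire M → Prop) : Prop :=
  ∀ p q, F' p q ↔ ∃ P Q : Baire M, P.val = p ∧ Q.val = q ∧ F P Q

omit [ZFModel M] in
theorem Presents.iff {F' : M → M → Prop} {F : Baire M → Baire M → Prop} (h : Presents F' F)
    (P Q : Baire M) : F' P.val Q.val ↔ F P Q := by
  rw [h]
  constructor
  · rintro ⟨P', Q', hP, hQ, h⟩
    rwa [← Baire.eq_of_val hP, ← Baire.eq_of_val hQ]
  · exact fun h => ⟨P, Q, rfl, rfl, h⟩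

theorem Presents.dom_iff {F' : M → M → Prop} {F : Baire M → Omega M → Prop}
    (h : Presents F' (onZero F)) (P : Baire M) : (∃ q, F' P.val q) ↔ ∃ n, F P n := by
  constructor
  · rintro ⟨q, hq⟩
    obtain ⟨P', Q, hP, -, hF⟩ := (h _ _).1 hq
    exact ⟨Q 0, (Baire.eq_of_val hP) ▸ hF⟩
  · rintro ⟨n, hn⟩
    refine ⟨(const n).val, (h.iff P (const n)).2 ?_⟩
    rwa [onZero, const_app]

/-- Since the first problem asks for a number, only the value at `0` of the output of `K` matters.
-/
theorem Red.of_contRed {F' G' : M → M → Prop} {F : Baire M → Omega M → Prop}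
    {G : Baire M → Baire M → Prop} (hF : Presents F' (onZero F)) (hG : Presents G' G)
    (h : ContRed F' G') : Red F G := by
  obtain ⟨H, K, hH, hK, h⟩ := h
  have uH : ∀ p r r' : Baire M, Rel H p.val r.val → Rel H p.val r'.val → r = r' :=
    fun p r r' h h' => Baire.eq_of_val (hH.1.2 _ _ _ h h')
  obtain ⟨Hf, dH, hHf⟩ := exists_dfun (R := fun p r : Baire M => Rel H p.val r.val)
    (inferInstance : Dfn M fun e : Baire M × Baire M => Rel H e.1.val e.2.val) uH
  have uK : ∀ p q r r' : Baire M, Rel₂ K p.val q.val r.val → Rel₂ K p.val q.val r'.val →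
      r = r' := by
    rintro p q r r' ⟨z, hz, h⟩ ⟨z', hz', h'⟩
    rw [isOPair_iff] at hz hz'
    subst hz hz'
    exact Baire.eq_of_val (hK.1.2 _ _ _ h h')
  have dR : Dfn M fun e : (Baire M × Baire M) × Omega M =>
      ∃ r : Baire M, Rel₂ K e.1.1.val e.1.2.val r.val ∧ r 0 = e.2 := by
    simp only [rel₂_iff]; infer_instance
  have : Inhabited (Omega M) := ⟨0⟩
  obtain ⟨Kf, dK, hKf⟩ := exists_dfun (R := fun (e : Baire M × Baire M) (n : Omega M) =>
    ∃ r : Baire M, Rel₂ K e.1.val e.2.val r.val ∧ r 0 = n) dR (by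
      rintro ⟨p, q⟩ _ _ ⟨r, h, rfl⟩ ⟨r', h', rfl⟩
      rw [uK p q r r' h h'])
  have key : ∀ p, (∃ n, F p n) → Rel H p.val (Hf p).val ∧ (∃ q, G (Hf p) q) ∧
      ∀ q, G (Hf p) q → ∃ r : Baire M, Rel₂ K p.val q.val r.val ∧ F p (r 0) := by
    intro p hp
    obtain ⟨p', hp', ⟨q, hq⟩, hK'⟩ := h p.val ((hF.dom_iff p).2 hp)
    obtain ⟨P', Q, rfl, rfl, hQ⟩ := (hG _ _).1 hq
    rw [hHf p P' hp']
    refine ⟨hp', ⟨Q, hQ⟩, fun q hq => ?_⟩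
    obtain ⟨r, hr, hFr⟩ := hK' q.val ((hG.iff _ _).2 hq)
    obtain ⟨P, r', hP, rfl, h⟩ := (hF _ _).1 hFr
    obtain rfl := Baire.eq_of_val hP
    exact ⟨r', hr, h⟩
  refine ⟨Hf, fun p q => Kf (p, q), dH, dK, fun p hp n => ?_, fun p q hp hq => ?_,
    fun p hp => ⟨(key p hp).2.1, fun q hq => ?_⟩⟩
  -- Agreement is below a bound, so controlling the value at `n` takes precision `n + 1`; for `K`
  -- below, precision `1` controls the value at `0`.
  · obtain ⟨m, hm, hc⟩ := hH.2 _ _ (key p hp).1 n.succ.val n.succ.isNat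
    refine ⟨⟨m, hm⟩, fun p' hp' hpp' => ?_⟩
    exact agree_iff.1 (hc _ _ (key p' hp').1 ((agree_iff (n := ⟨m, hm⟩)).2 hpp')) n n.lt_succ_self
  · obtain ⟨r, hr, -⟩ := (key p hp).2.2 q hq
    obtain ⟨m, hm, hc⟩ := hK.2 _ _ _ hr (Omega.succ 0).val (Omega.succ 0).isNat
    refine ⟨⟨m, hm⟩, fun p' q' hp' hq' hpp' hqq' => ?_⟩
    obtain ⟨r', hr', -⟩ := (key p' hp').2.2 q' hq'
    dsimp only
    rw [hKf (p, q) _ ⟨r, hr, rfl⟩, hKf (p', q') _ ⟨r', hr', rfl⟩]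
    exact agree_iff.1 (hc _ _ _ hr' ((agree_iff (n := ⟨m, hm⟩)).2 hpp')
      ((agree_iff (n := ⟨m, hm⟩)).2 hqq')) 0 (Omega.lt_succ_self 0)
  · obtain ⟨r, hr, hFr⟩ := (key p hp).2.2 q hq
    dsimp only
    rwa [hKf (p, q) _ ⟨r, hr, rfl⟩]

/-- Finitely many moduli have a maximum. As `n` may be nonstandard, this is an induction inside the
model, which is where definability of `D` and `H` enters. -/
theorem uniform_modulus {D : Baire M → Prop} (hD : Dfn M D) {H : Baire M → Baire M}
    (dH : DFun M H) {p : Baire M}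
    (h : ∀ n, ∃ m, ∀ p', D p' → AgreeBelow m p p' → H p n = H p' n) (n : Omega M) :
    ∃ m, ∀ p', D p' → AgreeBelow m p p' → AgreeBelow n (H p) (H p') := by
  have hD' : ∀ {E : Type u} [Coded M E] (t : E → Baire M) [DFun M t], Dfn M fun e => D (t e) :=
    fun t => Dfn.comp hD t
  have hH' : ∀ {E : Type u} [Coded M E] (t : E → Baire M) [DFun M t], DFun M fun e => H (t e) :=
    fun t => DFun.comp H t
  refine Omega.induction (P := fun n => ∃ m, ∀ p', D p' → AgreeBelow m p p' →
    AgreeBelow n (H p) (H p')) inferInstance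
    ⟨0, fun _ _ _ k hk => (Omega.not_lt_zero k hk).elim⟩ (fun n ih => ?_) n
  obtain ⟨m, hm⟩ := ih
  obtain ⟨m', hm'⟩ := h n
  refine ⟨max m m', fun p' hp' ha k hk => ?_⟩
  rcases (Omega.lt_succ_iff.1 hk).lt_or_eq with hk | rfl
  · exact hm p' hp' (ha.mono (le_max_left _ _)) k hk
  · exact hm' p' hp' (ha.mono (le_max_right _ _))

/-- `H` and `K` are cut down to the instances, and to the pairs of an instance and a solution,
because only there are they known to be continuous. The number found by `K` is named by a constant
sequence. -/
theorem Red.contRed {F' G' : M → M → Prop} {F : Baire M → Omega M → Prop}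
    {G : Baire M → Baire M → Prop} (dF : Dfn M fun e : Baire M × Omega M => F e.1 e.2)
    (dG : Dfn M fun e : Baire M × Baire M => G e.1 e.2)
    (hF : Presents F' (onZero F)) (hG : Presents G' G)
    (h : Red F G) : ContRed F' G' := by
  obtain ⟨H, K, dH, dK, cH, cK, h⟩ := h
  have hF' : ∀ {E : Type u} [Coded M E] (t : E → Baire M) (s : E → Omega M) [DFun M t] [DFun M s],
    Dfn M fun e => F (t e) (s e) := fun t s => Dfn.comp₂ dF t s
  have hG' : ∀ {E : Type u} [Coded M E] (t s : E → Baire M) [DFun M t] [DFun M s],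
    Dfn M fun e => G (t e) (s e) := fun t s => Dfn.comp₂ dG t s
  have dH' : ∀ {E : Type u} [Coded M E] (t : E → Baire M) [DFun M t], DFun M fun e => H (t e) :=
    fun t => DFun.comp H t
  have dK' : ∀ {E : Type u} [Coded M E] (t s : E → Baire M) [DFun M t] [DFun M s],
    DFun M fun e => K (t e) (s e) := fun t s => DFun.comp₂ dK t s
  obtain ⟨Hs, hHs⟩ := comprehension (M := M) fun e : Baire M × Baire M =>
    (∃ n, F e.1 n) ∧ H e.1 = e.2
  obtain ⟨Ks, hKs⟩ := comprehension (M := M) fun e : (Baire M × Baire M) × Baire M =>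
    ((∃ n, F e.1.1 n) ∧ G (H e.1.1) e.1.2) ∧ const (K e.1.1 e.1.2) = e.2
  have relH : ∀ p r, Rel Hs p r ↔ ∃ P : Baire M, P.val = p ∧ (H P).val = r ∧ ∃ n, F P n := by
    intro p r
    rw [WeihrauchAD.rel_iff, hHs]
    constructor
    · rintro ⟨⟨P, R⟩, he, hP, hR⟩
      dsimp only at hP hR
      subst hR
      obtain ⟨rfl, rfl⟩ := opair_inj.1 he
      exact ⟨P, rfl, rfl, hP⟩
    · rintro ⟨P, rfl, rfl, hP⟩
      exact ⟨(P, H P), rfl, hP, rfl⟩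
  have relK : ∀ z r, Rel Ks z r ↔ ∃ P Q : Baire M, opair P.val Q.val = z ∧
      (const (K P Q)).val = r ∧ (∃ n, F P n) ∧ G (H P) Q := by
    intro z r
    rw [WeihrauchAD.rel_iff, hKs]
    constructor
    · rintro ⟨⟨⟨P, Q⟩, R⟩, he, hP, hR⟩
      dsimp only at hP hR
      subst hR
      obtain ⟨rfl, rfl⟩ := opair_inj.1 he
      exact ⟨P, Q, rfl, rfl, hP⟩
    · rintro ⟨P, Q, rfl, rfl, hP⟩
      exact ⟨((P, Q), const (K P Q)), rfl, hP, rfl⟩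
  have relK₂ : ∀ p q r, Rel₂ Ks p q r ↔ ∃ P Q : Baire M, P.val = p ∧ Q.val = q ∧
      (const (K P Q)).val = r ∧ (∃ n, F P n) ∧ G (H P) Q := by
    intro p q r
    simp only [Rel₂, isOPair_iff, exists_eq_left, relK, opair_inj, and_assoc]
  refine ⟨Hs, Ks, ⟨⟨fun z hz => ?_, fun a b b' h1 h2 => ?_⟩, fun p r hpr n hn => ?_⟩,
    ⟨⟨fun z hz => ?_, fun a b b' h1 h2 => ?_⟩, fun p q r hpq n hn => ?_⟩, fun p hp => ?_⟩
  · obtain ⟨e, rfl, -⟩ := (hHs z).1 hz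
    exact ⟨_, _, e.1.isBaire, e.2.isBaire, isOPair_opair _ _⟩
  · obtain ⟨P, rfl, rfl, -⟩ := (relH _ _).1 h1
    obtain ⟨P', hP, rfl, -⟩ := (relH _ _).1 h2
    rw [Baire.eq_of_val hP]
  · obtain ⟨P, rfl, rfl, hP⟩ := (relH _ _).1 hpr
    obtain ⟨m, hm⟩ := uniform_modulus (D := fun p => ∃ n, F p n) inferInstance dH (cH P hP)
      (⟨n, hn⟩ : Omega M)
    refine ⟨m.val, m.isNat, fun p' r' hpr' ha => ?_⟩
    obtain ⟨P', rfl, rfl, hP'⟩ := (relH _ _).1 hpr'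
    exact (agree_iff (n := ⟨n, hn⟩)).2 (hm P' hP' (agree_iff.1 ha))
  · obtain ⟨e, rfl, -⟩ := (hKs z).1 hz
    exact ⟨_, _, ⟨_, _, e.1.1.isBaire, e.1.2.isBaire, isOPair_opair _ _⟩, e.2.isBaire,
      isOPair_opair _ _⟩
  · obtain ⟨P, Q, rfl, rfl, -⟩ := (relK _ _).1 h1
    obtain ⟨P', Q', hP, rfl, -⟩ := (relK _ _).1 h2
    obtain ⟨hP, hQ⟩ := opair_inj.1 hP
    rw [Baire.eq_of_val hP, Baire.eq_of_val hQ]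
  · obtain ⟨P, Q, rfl, rfl, rfl, hP, hQ⟩ := (relK₂ _ _ _).1 hpq
    obtain ⟨m, hm⟩ := cK P Q hP hQ
    refine ⟨m.val, m.isNat, fun p' q' r' hpq' ha ha' => ?_⟩
    obtain ⟨P', Q', rfl, rfl, rfl, hP', hQ'⟩ := (relK₂ _ _ _).1 hpq'
    rw [hm P' Q' hP' hQ' (agree_iff.1 ha) (agree_iff.1 ha')]
    exact fun _ _ _ => Iff.rfl
  · obtain ⟨r, hr⟩ := hp
    obtain ⟨P, R, rfl, rfl, hPR⟩ := (hF _ _).1 hr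
    have hP : ∃ n, F P n := ⟨_, hPR⟩
    obtain ⟨⟨q, hq⟩, hK⟩ := h P hP
    refine ⟨_, (relH _ _).2 ⟨P, rfl, rfl, hP⟩, ⟨q.val, (hG.iff _ _).2 hq⟩, fun q hq => ?_⟩
    obtain ⟨P', Q, hP', rfl, hQ⟩ := (hG _ _).1 hq
    rw [Baire.eq_of_val hP'] at hQ
    refine ⟨_, (relK₂ _ _ _).2 ⟨P, Q, rfl, rfl, rfl, hP, hQ⟩, (hF.iff _ _).2 ?_⟩
    rw [onZero, const_app]
    exact hK Q hQ

/-- The number returned by the inner reduction is passed to the outer one as a constant sequence.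
Continuity of the composition needs a modulus of `H` for whole prefixes, hence `uniform_modulus`. -/
theorem Red.trans {F G : Baire M → Omega M → Prop} {P : Baire M → Baire M → Prop}
    (h : Red F (onZero G)) (h' : Red G P) (dF : Dfn M fun e : Baire M × Omega M => F e.1 e.2) :
    Red F P := by
  obtain ⟨H, K, dH, dK, cH, cK, h⟩ := h
  obtain ⟨H', K', dH', dK', cH', cK', h'⟩ := h'
  have hF' : ∀ {E : Type u} [Coded M E] (t : E → Baire M) (s : E → Omega M) [DFun M t] [DFun M s],
    Dfn M fun e => F (t e) (s e) := fun t s => Dfn.comp₂ dF t s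
  have eH : ∀ {E : Type u} [Coded M E] (t : E → Baire M) [DFun M t], DFun M fun e => H (t e) :=
    fun t => DFun.comp H t
  have eH' : ∀ {E : Type u} [Coded M E] (t : E → Baire M) [DFun M t], DFun M fun e => H' (t e) :=
    fun t => DFun.comp H' t
  have eK : ∀ {E : Type u} [Coded M E] (t s : E → Baire M) [DFun M t] [DFun M s],
    DFun M fun e => K (t e) (s e) := fun t s => DFun.comp₂ dK t s
  have eK' : ∀ {E : Type u} [Coded M E] (t s : E → Baire M) [DFun M t] [DFun M s],
    DFun M fun e => K' (t e) (s e) := fun t s => DFun.comp₂ dK' t s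
  have hdom : ∀ p, (∃ n, F p n) → ∃ n, G (H p) n := fun p hp => by
    obtain ⟨⟨q, hq⟩, -⟩ := h p hp
    exact ⟨_, hq⟩
  have uni := fun p hp =>
    uniform_modulus (D := fun p => ∃ n, F p n) (p := p) inferInstance dH (cH p hp)
  have hG : ∀ p q, (∃ n, F p n) → P (H' (H p)) q → onZero G (H p) (const (K' (H p) q)) :=
    fun p q hp hq => by
      rw [onZero, const_app]
      exact (h' _ (hdom p hp)).2 q hq
  refine ⟨fun p => H' (H p), fun p q => K p (const (K' (H p) q)), inferInstance, inferInstance,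
    fun p hp n => ?_, fun p q hp hq => ?_, fun p hp => ⟨(h' _ (hdom p hp)).1, fun q hq =>
      (h p hp).2 _ (hG p q hp hq)⟩⟩
  · obtain ⟨m, hm⟩ := cH' (H p) (hdom p hp) n
    obtain ⟨k, hk⟩ := uni p hp m
    exact ⟨k, fun p' hp' ha => hm _ (hdom p' hp') (hk p' hp' ha)⟩
  · obtain ⟨m₁, hm₁⟩ := cK p _ hp (hG p q hp hq)
    obtain ⟨m₂, hm₂⟩ := cK' (H p) q (hdom p hp) hq
    obtain ⟨k, hk⟩ := uni p hp m₂
    refine ⟨max m₁ (max m₂ k), fun p' q' hp' hq' ha ha' => ?_⟩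
    have e : K' (H p) q = K' (H p') q' := hm₂ _ _ (hdom p' hp') hq'
      (hk p' hp' (ha.mono ((le_max_right _ _).trans (le_max_right _ _))))
      (ha'.mono ((le_max_left _ _).trans (le_max_right _ _)))
    refine hm₁ _ _ hp' (hG p' q' hp' hq') (ha.mono (le_max_left _ _)) ?_
    rw [e]
    exact AgreeBelow.refl _ _

/-! ### Games -/

theorem exists_isRestr (p : Baire M) (n : Omega M) : ∃ s : M, IsRestr s p.val n.val := by
  obtain ⟨s, hs⟩ := comprehension (M := M) fun e : Omega M × Omega M => e.1 < n ∧ p e.1 = e.2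
  refine ⟨s, fun z => (hs z).trans ⟨?_, ?_⟩⟩
  · rintro ⟨⟨k, v⟩, rfl, hk, hv⟩
    exact ⟨WeihrauchAD.rel_iff.1 (Baire.rel_iff.2 hv), k.val, v.val, hk, isOPair_opair _ _⟩
  · rintro ⟨hz, k, v, hk, hkv⟩
    rw [isOPair_iff] at hkv
    subst hkv
    obtain ⟨hk', hv'⟩ := rel_isNat p.isBaire (WeihrauchAD.rel_iff.2 hz)
    exact ⟨(⟨k, hk'⟩, ⟨v, hv'⟩), rfl, hk,
      (Baire.rel_iff (n := ⟨k, hk'⟩) (m := ⟨v, hv'⟩)).1 (WeihrauchAD.rel_iff.2 hz)⟩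

theorem IsRestr.isFinSeq {s : M} {p : Baire M} {n : Omega M} (h : IsRestr s p.val n.val) :
    IsFinSeq s := by
  refine ⟨n.val, n.isNat, ⟨fun z hz => ?_, fun a b b' h1 h2 => ?_⟩, fun a ha => ?_⟩
  · obtain ⟨hp, k, v, hk, hkv⟩ := (h z).1 hz
    refine ⟨k, v, hk, ?_, hkv⟩
    rw [isOPair_iff] at hkv
    subst hkv
    exact (rel_isNat p.isBaire (WeihrauchAD.rel_iff.2 hp)).2
  · rw [WeihrauchAD.rel_iff] at h1 h2
    exact p.isBaire.1.2 a b b' (WeihrauchAD.rel_iff.2 ((h _).1 h1).1)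
      (WeihrauchAD.rel_iff.2 ((h _).1 h2).1)
  · have := rel_app p ⟨a, Omega.isNat_of_mem ha⟩
    exact ⟨_, WeihrauchAD.rel_iff.2 ((h _).2 ⟨WeihrauchAD.rel_iff.1 this, _, _, ha,
      isOPair_opair _ _⟩)⟩

theorem IsRestr.congr {s : M} {p q : Baire M} {n : Omega M} (h : IsRestr s p.val n.val)
    (ha : AgreeBelow n p q) : IsRestr s q.val n.val := by
  intro z
  rw [h z]
  have := agree_iff.2 ha
  constructor <;>
  · rintro ⟨hz, k, v, hk, hkv⟩
    refine ⟨?_, k, v, hk, hkv⟩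
    rw [isOPair_iff] at hkv
    subst hkv
    rw [← WeihrauchAD.rel_iff] at hz ⊢
    first | exact (this k hk v).1 hz | exact (this k hk v).2 hz

instance dfn_isRestr {X : Type u} [Coded M X] (f g h : X → M) [DFun M f] [DFun M g] [DFun M h] :
    Dfn M fun x => IsRestr (f x) (g x) (h x) := by
  have hf : ∀ {E : Type u} [Coded M E] (t : E → X) [DFun M t], DFun M fun e => f (t e) :=
    fun t => DFun.comp f t
  have hg : ∀ {E : Type u} [Coded M E] (t : E → X) [DFun M t], DFun M fun e => g (t e) :=
    fun t => DFun.comp g t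
  have hh : ∀ {E : Type u} [Coded M E] (t : E → X) [DFun M t], DFun M fun e => h (t e) :=
    fun t => DFun.comp h t
  unfold IsRestr; infer_instance

/-- The sequence of moves prescribed by the strategy `σ` that sees at stage `n` the first `t n`
moves of the opponent. -/
theorem exists_play {σ : M} (hσ : IsMap IsFinSeq IsNat σ) (t : Omega M → Omega M)
    (dt : DFun M t) : ∃ S : Baire M → Baire M, DFun M S ∧
      (∀ p n s k, IsRestr s p.val (t n).val → Rel (S p).val n.val k → Rel σ s k) ∧
      ∀ p p' n, AgreeBelow (t n) p p' → S p n = S p' n := by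
  have dt' : ∀ {E : Type u} [Coded M E] (s : E → Omega M) [DFun M s], DFun M fun e => t (s e) :=
    fun s => DFun.comp t s
  -- Since `σ` is a function, `mu` picks the only possible move; it serves to make the move
  -- definable.
  let mv : Baire M → Omega M → Omega M := fun p n =>
    Omega.mu fun v => ∃ s : M, IsRestr s p.val (t n).val ∧ Rel σ s v.val
  have hmv : ∀ p n s, IsRestr s p.val (t n).val → Rel σ s (mv p n).val := by
    intro p n s hs
    obtain ⟨b, hb⟩ := hσ.2 s hs.isFinSeq
    obtain ⟨z, hz, hm⟩ := id hb
    obtain ⟨a', b', -, hb', h⟩ := hσ.1.1 z hm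
    rw [isOPair_iff] at hz h
    obtain ⟨-, rfl⟩ := opair_inj.1 (hz.symm.trans h)
    have := (Omega.mu_spec (P := fun v => ∃ s : M, IsRestr s p.val (t n).val ∧ Rel σ s v.val)
      inferInstance ⟨⟨b, hb'⟩, s, hs, hb⟩).1
    obtain ⟨s', hs', h'⟩ := this
    rwa [set_ext fun x => (hs x).trans (hs' x).symm]
  have happ : ∀ p n, (lam fun n => mv p n) n = mv p n := fun p n => lam_app _ n
  refine ⟨fun p => lam fun n => mv p n, inferInstance, fun p n s k hs hk => ?_,
    fun p p' n ha => ?_⟩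
  · have hk' := (rel_isNat (Baire.isBaire _) hk).2
    have h1 := (Baire.rel_iff (m := ⟨k, hk'⟩)).1 hk
    rw [happ] at h1
    have := hmv p n s hs
    rwa [h1] at this
  · rw [happ, happ]
    obtain ⟨s, hs⟩ := exists_isRestr p (t n)
    exact Omega.ext (hσ.1.2 _ _ _ (hmv p n s hs) (hmv p' n s (hs.congr ha)))

/-- Determinacy of the game with a definable payoff set, in terms of the functions
on Baire space induced by strategies. -/
theorem determinacy (hAD : AD M) (A : Baire M → Baire M → Prop)
    (dA : Dfn M fun e : Baire M × Baire M => A e.1 e.2) :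
    (∃ S : Baire M → Baire M, DFun M S ∧ (∀ y y' n, AgreeBelow n y y' → S y n = S y' n) ∧
      ∀ y, A (S y) y) ∨
    ∃ T : Baire M → Baire M, DFun M T ∧
      (∀ x x' n, AgreeBelow n.succ x x' → T x n = T x' n) ∧ ∀ x, ¬ A x (T x) := by
  obtain ⟨a, ha⟩ := comprehension (M := M) fun e : Baire M × Baire M => A e.1 e.2
  have hA : ∀ x y : Baire M, Rel a x.val y.val ↔ A x y := by
    intro x y
    rw [WeihrauchAD.rel_iff, ha]
    exact exists_code_prod_eq
  rcases hAD a with ⟨σ, hσ, h⟩ | ⟨τ, hτ, h⟩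
  -- Player I moves first and sees `n` moves before the `n`-th answer; player II, below, sees `n +
  -- 1`.
  · obtain ⟨S, dS, hS, cS⟩ := exists_play hσ (fun n => n) inferInstance
    refine Or.inl ⟨S, dS, cS, fun y => (hA _ _).1 (h _ _ (S y).isBaire y.isBaire ?_)⟩
    exact fun n s k hn hs hk => hS y ⟨n, hn⟩ s k hs hk
  · obtain ⟨T, dT, hT, cT⟩ := exists_play hτ (fun n => n.succ) inferInstance
    refine Or.inr ⟨T, dT, cT, fun x hx => h _ _ x.isBaire (T x).isBaire ?_ ((hA _ _).2 hx)⟩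
    intro n n' s k hn hn' hs hk
    refine hT x ⟨n, hn⟩ s k ?_ hk
    rwa [← Omega.isSucc_iff.1 (show IsSucc n' (Omega.val ⟨n, hn⟩) from hn')]

end Reductions

section Problems

variable {M : Type u} [SetStructure M] [ZFModel M]

/-! ### The problems on the level of definable predicates -/

omit [ZFModel M] in
theorem IsNat.exists_val_eq {n : M} (h : IsNat n) : ∃ m : Omega M, m.val = n := ⟨⟨n, h⟩, rfl⟩

omit [ZFModel M] in
theorem IsBaire.exists_val_eq {p : M} (h : IsBaire p) : ∃ q : Baire M, q.val = p := ⟨⟨p, h⟩, rfl⟩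

theorem namesNat_iff {q n : M} :
    NamesNat q n ↔ ∃ Q : Baire M, Q.val = q ∧ (Q 0).val = n := by
  constructor
  · rintro ⟨hq, hn, e, he, h⟩
    rw [Omega.isVoid_iff] at he
    subst he
    exact ⟨⟨q, hq⟩, rfl,
      congrArg Omega.val ((Baire.rel_iff (p := ⟨q, hq⟩) (n := 0) (m := ⟨n, hn⟩)).1 h)⟩
  · rintro ⟨Q, rfl, rfl⟩
    exact ⟨Q.isBaire, (Q 0).isNat, _, Omega.isVoid_zero, rel_app Q 0⟩

theorem enumerates_iff {p : Baire M} {n : Omega M} :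
    Enumerates p.val n.val ↔ ∃ i, p i = n.succ := by
  constructor
  · rintro ⟨i, s, hs, h⟩
    rw [Omega.isSucc_iff] at hs
    subst hs
    exact ⟨⟨i, (rel_isNat p.isBaire h).1⟩, Baire.rel_iff.1 h⟩
  · rintro ⟨i, h⟩
    exact ⟨i.val, n.succ.val, Omega.isSucc_succ n, Baire.rel_iff.2 h⟩

/-- Closed choice on the natural numbers. -/
def Unenumerated (p : Baire M) (n : Omega M) : Prop := ¬ ∃ i, p i = n.succ

instance dfn_unenumerated {X : Type u} [Coded M X] (f : X → Baire M) (g : X → Omega M)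
    [DFun M f] [DFun M g] : Dfn M fun x => Unenumerated (f x) (g x) :=
  Dfn.comp₂ (by unfold Unenumerated; infer_instance) f g

theorem presents_closedChoice : Presents (M := M) closedChoice (onZero Unenumerated) := by
  intro p q
  constructor
  · rintro ⟨hp, n, hq, hn⟩
    obtain ⟨Q, rfl, rfl⟩ := namesNat_iff.1 hq
    exact ⟨⟨p, hp⟩, Q, rfl, rfl, fun h => hn ((enumerates_iff (p := ⟨p, hp⟩)).2 h)⟩
  · rintro ⟨P, Q, rfl, rfl, h⟩
    exact ⟨P.isBaire, _, namesNat_iff.2 ⟨Q, rfl, rfl⟩, fun hn => h (enumerates_iff.1 hn)⟩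

theorem IsDouble.rel_iff {d : M} (hd : IsDouble d) (n m : Omega M) :
    Rel d n.val m.val ↔ double M n = m := by
  obtain ⟨hB, h0, hs⟩ := hd
  obtain ⟨D, rfl⟩ := hB.exists_val_eq
  have : D = double M := by
    refine rec_unique (F := fun _ v => v.succ.succ) ?_ (fun n => ?_) double_succ
    · rw [double_zero]
      exact Baire.rel_iff.1 (h0 _ Omega.isVoid_zero)
    · exact Baire.rel_iff.1 (hs _ _ _ _ _ (Omega.isSucc_succ n) (rel_app D n)
        (Omega.isSucc_succ _) (Omega.isSucc_succ _))
  rw [← this]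
  exact Baire.rel_iff

theorem isDouble_double : IsDouble (double M).val := by
  refine ⟨Baire.isBaire _, fun e he => ?_, fun n n' k k' k'' hn hnk hk hk' => ?_⟩
  · rw [Omega.isVoid_iff] at he
    rw [he]
    exact Baire.rel_iff.2 double_zero
  · obtain ⟨hn', hk''⟩ := rel_isNat (Baire.isBaire _) hnk
    obtain ⟨n, rfl⟩ := hn'.exists_val_eq
    obtain ⟨k, rfl⟩ := hk''.exists_val_eq
    obtain rfl := Omega.isSucc_iff.1 hn
    obtain rfl := Omega.isSucc_iff.1 hk
    obtain rfl := Omega.isSucc_iff.1 hk'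
    rw [Baire.rel_iff] at hnk ⊢
    rw [double_succ, hnk]

/-- The recursion equations determine a pairing function by induction on `a`. With
`exists_isPairing` this makes the choice of `c` in `IsSection` immaterial. -/
theorem IsPairing.rel_iff {c : M} (hc : IsPairing c) (a b l : Omega M) :
    Rel₂ c a.val b.val l.val ↔ pair a b = l := by
  obtain ⟨hm, d, hd, h0, hs⟩ := hc
  have key : ∀ a : Omega M, Rel₂ c a.val b.val (pair a b).val := by
    refine Omega.induction (by simp only [rel₂_iff]; infer_instance) ?_ fun a ih => ?_
    · rw [pair_zero]
      exact h0 _ _ _ Omega.isVoid_zero ((hd.rel_iff _ _).2 rfl)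
    · rw [pair_succ]
      exact hs _ _ _ _ _ _ (Omega.isSucc_succ a) ih ((hd.rel_iff _ _).2 rfl) (Omega.isSucc_succ _)
  refine ⟨fun h => ?_, fun h => h ▸ key a⟩
  obtain ⟨z, hz, h⟩ := h
  obtain ⟨z', hz', h'⟩ := key a
  rw [isOPair_iff] at hz hz'
  subst hz hz'
  exact Omega.ext (hm.1.2 _ _ _ h' h)

variable (M) in
theorem exists_isPairing : ∃ c : M, IsPairing c := by
  obtain ⟨c, hc⟩ := comprehension (M := M) fun e : (Omega M × Omega M) × Omega M =>
    pair e.1.1 e.1.2 = e.2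
  have rc : ∀ z l, Rel c z l ↔ ∃ a b : Omega M, opair a.val b.val = z ∧ (pair a b).val = l := by
    intro z l
    rw [WeihrauchAD.rel_iff, hc]
    constructor
    · rintro ⟨⟨⟨a, b⟩, v⟩, he, hv⟩
      obtain ⟨rfl, rfl⟩ := opair_inj.1 he
      exact ⟨a, b, rfl, congrArg Omega.val hv⟩
    · rintro ⟨a, b, rfl, rfl⟩
      exact ⟨((a, b), pair a b), rfl, rfl⟩
  have rc₂ : ∀ a b l : M, Rel₂ c a b l ↔
      ∃ a' b' : Omega M, a'.val = a ∧ b'.val = b ∧ (pair a' b').val = l := by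
    intro a b l
    simp only [Rel₂, isOPair_iff, exists_eq_left, rc, opair_inj, and_assoc]
  refine ⟨c, ⟨⟨fun z hz => ?_, fun z l l' h h' => ?_⟩, ?_⟩, _, isDouble_double, ?_, ?_⟩
  · obtain ⟨e, rfl, -⟩ := (hc z).1 hz
    exact ⟨_, _, ⟨_, _, e.1.1.isNat, e.1.2.isNat, isOPair_opair _ _⟩, e.2.isNat,
      isOPair_opair _ _⟩
  · obtain ⟨a, b, rfl, rfl⟩ := (rc _ _).1 h
    obtain ⟨a', b', he, rfl⟩ := (rc _ _).1 h'
    obtain ⟨ha, hb⟩ := opair_inj.1 he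
    rw [Omega.ext ha, Omega.ext hb]
  · rintro z ⟨a, b, ha, hb, hz⟩
    rw [isOPair_iff] at hz
    exact ⟨_, (rc _ _).2 ⟨⟨a, ha⟩, ⟨b, hb⟩, hz.symm, rfl⟩⟩
  · intro e b k he hbk
    rw [Omega.isVoid_iff] at he
    obtain ⟨hb, hk⟩ := rel_isNat (Baire.isBaire _) hbk
    obtain ⟨b, rfl⟩ := hb.exists_val_eq
    obtain ⟨k, rfl⟩ := hk.exists_val_eq
    rw [Baire.rel_iff] at hbk
    refine (rc₂ _ _ _).2 ⟨0, b, he.symm, rfl, ?_⟩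
    rw [pair_zero, hbk]
  · intro a a' b k l l' ha hk hkl hl
    obtain ⟨A, B, rfl, rfl, rfl⟩ := (rc₂ _ _ _).1 hk
    obtain ⟨-, hl'⟩ := rel_isNat (Baire.isBaire _) hkl
    obtain ⟨l, rfl⟩ := hl'.exists_val_eq
    rw [Baire.rel_iff] at hkl
    obtain rfl := Omega.isSucc_iff.1 hl
    obtain rfl := Omega.isSucc_iff.1 ha
    refine (rc₂ _ _ _).2 ⟨A.succ, B, rfl, rfl, ?_⟩
    rw [pair_succ, hkl]

theorem isSection_iff {r : M} {p : Baire M} {k : Omega M} :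
    IsSection r p.val k.val ↔ ∃ R : Baire M, R.val = r ∧ ∀ j, R j = p (pair k j) := by
  constructor
  · rintro ⟨hr, c, hc, h⟩
    exact ⟨⟨r, hr⟩, rfl, fun j =>
      Baire.rel_iff.1 (h _ _ _ ((hc.rel_iff _ _ _).2 rfl) (rel_app p (pair k j)))⟩
  · rintro ⟨R, rfl, h⟩
    obtain ⟨c, hc⟩ := exists_isPairing M
    refine ⟨R.isBaire, c, hc, fun j i v hi hv => ?_⟩
    obtain ⟨hi', hv'⟩ := rel_isNat p.isBaire hv
    -- Here `j` is an arbitrary set of the model; it is a number because `c` is defined only on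
    -- pairs of numbers.
    have hj : IsNat j := by
      obtain ⟨z, hz, z', hz', hm⟩ := hi
      obtain ⟨a, b, ⟨a', b', ha, hb, hab⟩, -, h'⟩ := hc.1.1.1 z' hm
      rw [isOPair_iff] at hz hz' hab h'
      obtain ⟨h1, -⟩ := opair_inj.1 (hz'.symm.trans h')
      obtain ⟨-, h2⟩ := opair_inj.1 (hz.symm.trans (h1.trans hab))
      exact h2 ▸ hb
    obtain ⟨j, rfl⟩ := hj.exists_val_eq
    obtain ⟨i, rfl⟩ := hi'.exists_val_eq
    obtain ⟨v, rfl⟩ := hv'.exists_val_eq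
    rw [hc.rel_iff] at hi
    rw [Baire.rel_iff] at hv ⊢
    rw [h, hi, hv]

/-- `n` belongs to the intersection of the sets enumerated by the sections of `p`. -/
def InInter (p : Baire M) (n : Omega M) : Prop := ∀ k, ∃ j, p (pair k j) = n.succ

instance dfn_inInter {X : Type u} [Coded M X] (f : X → Baire M) (g : X → Omega M)
    [DFun M f] [DFun M g] : Dfn M fun x => InInter (f x) (g x) :=
  Dfn.comp₂ (by unfold InInter; infer_instance) f g

theorem inPi2_iff {p : Baire M} {n : Omega M} : InPi2 p.val n.val ↔ InInter p n := by
  constructor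
  · intro h k
    obtain ⟨r, hr, he⟩ := h k.val k.isNat
    obtain ⟨R, rfl, hR⟩ := isSection_iff.1 hr
    obtain ⟨j, hj⟩ := enumerates_iff.1 he
    exact ⟨j, (hR j).symm.trans hj⟩
  · intro h k hk
    obtain ⟨k, rfl⟩ := hk.exists_val_eq
    obtain ⟨j, hj⟩ := h k
    have := lam_app (fun j => p (pair k j))
    exact ⟨_, isSection_iff.2 ⟨_, rfl, this⟩,
      enumerates_iff.2 ⟨j, (this j).trans hj⟩⟩

/-- The problem `Π⁰₂ACC` on the natural numbers. -/
def Pi2Choice (p : Baire M) (n : Omega M) : Prop :=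
  (∀ a b, ¬ InInter p a → ¬ InInter p b → a = b) ∧ InInter p n

instance dfn_pi2Choice {X : Type u} [Coded M X] (f : X → Baire M) (g : X → Omega M)
    [DFun M f] [DFun M g] : Dfn M fun x => Pi2Choice (f x) (g x) :=
  Dfn.comp₂ (by unfold Pi2Choice; infer_instance) f g

theorem presents_pi2ACC : Presents (M := M) pi2ACC (onZero Pi2Choice) := by
  intro p q
  constructor
  · rintro ⟨hp, hu, n, hq, hn⟩
    obtain ⟨Q, rfl, rfl⟩ := namesNat_iff.1 hq
    refine ⟨⟨p, hp⟩, Q, rfl, rfl, fun a b ha hb => ?_, inPi2_iff.1 hn⟩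
    exact Omega.ext (hu _ _ a.isNat b.isNat (fun h => ha (inPi2_iff.1 h))
      fun h => hb (inPi2_iff.1 h))
  · rintro ⟨P, Q, rfl, rfl, hu, h⟩
    refine ⟨P.isBaire, fun m n hm hn h1 h2 => ?_, _, namesNat_iff.2 ⟨Q, rfl, rfl⟩, inPi2_iff.2 h⟩
    exact congrArg Omega.val (hu ⟨m, hm⟩ ⟨n, hn⟩ (fun h => h1 (inPi2_iff.2 h))
      fun h => h2 (inPi2_iff.2 h))

theorem presents_firstOrder {g : M} (hg : IsFirstOrder g) :
    Presents (firstOrderOnNames g) (onZero fun p n => Rel g p.val n.val) := by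
  intro p q
  constructor
  · rintro ⟨n, hq, h⟩
    obtain ⟨Q, rfl, rfl⟩ := namesNat_iff.1 hq
    obtain ⟨z, hz, hm⟩ := id h
    obtain ⟨a, b, ha, -, hab⟩ := hg z hm
    rw [isOPair_iff] at hz hab
    obtain ⟨rfl, -⟩ := opair_inj.1 (hz.symm.trans hab)
    exact ⟨⟨p, ha⟩, Q, rfl, rfl, h⟩
  · rintro ⟨P, Q, rfl, rfl, h⟩
    exact ⟨_, namesNat_iff.2 ⟨Q, rfl, rfl⟩, h⟩

theorem RepSpace.isBaire_name (S : RepSpace M) {p x : M} (h : Rel S.rep p x) : IsBaire p := by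
  obtain ⟨z, hz, hm⟩ := h
  obtain ⟨a, b, ha, -, hab⟩ := S.rep_partialMap.1 z hm
  rw [isOPair_iff] at hz hab
  obtain ⟨rfl, -⟩ := opair_inj.1 (hz.symm.trans hab)
  exact ha

theorem Problem.presents (f : Problem M) :
    Presents f.onNames fun p q => f.onNames p.val q.val := by
  intro p q
  constructor
  · intro h
    obtain ⟨x, y, hp, hq, -⟩ := id h
    exact ⟨⟨p, f.source.isBaire_name hp⟩, ⟨q, f.target.isBaire_name hq⟩, rfl, rfl, h⟩
  · rintro ⟨P, Q, rfl, rfl, h⟩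
    exact h

instance Problem.dfn (f : Problem M) :
    Dfn M fun e : Baire M × Baire M => f.onNames e.1.val e.2.val := by
  unfold Problem.onNames; infer_instance

/-- A definable problem is given by a set. -/
theorem exists_isFirstOrder (F : Baire M → Omega M → Prop)
    (dF : Dfn M fun e : Baire M × Omega M => F e.1 e.2) :
    ∃ g : M, IsFirstOrder g ∧ Presents (firstOrderOnNames g) (onZero F) := by
  obtain ⟨g, hg⟩ := comprehension (M := M) fun e : Baire M × Omega M => F e.1 e.2
  have hF : IsFirstOrder g := by
    intro z hz
    obtain ⟨e, rfl, -⟩ := (hg z).1 hz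
    exact ⟨_, _, e.1.isBaire, e.2.isNat, isOPair_opair _ _⟩
  refine ⟨g, hF, ?_⟩
  convert presents_firstOrder hF using 1
  funext p q
  refine propext (Iff.symm ?_)
  rw [onZero, WeihrauchAD.rel_iff, hg]
  exact exists_code_prod_eq

/-! ### Avoiding the limit of a sequence -/

/-- The number `n` is not the limit of the sequence `z`. -/
def NotLimit (z : Baire M) (n : Omega M) : Prop := ¬ ∃ s, ∀ t, s ≤ t → z t = n

instance dfn_notLimit {X : Type u} [Coded M X] (f : X → Baire M) (g : X → Omega M)
    [DFun M f] [DFun M g] : Dfn M fun x => NotLimit (f x) (g x) :=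
  Dfn.comp₂ (by unfold NotLimit; infer_instance) f g

theorem limit_unique {z : Baire M} {m n : Omega M} (hm : ¬ NotLimit z m) (hn : ¬ NotLimit z n) :
    m = n := by
  obtain ⟨s, hs⟩ := not_not.1 hm
  obtain ⟨t, ht⟩ := not_not.1 hn
  exact (hs _ (le_max_left s t)).symm.trans (ht _ (le_max_right s t))

/-- Limits are unique and there are at least two numbers. So `NotLimit` is total, and later
arguments may feed it any sequence. -/
theorem exists_notLimit (z : Baire M) : ∃ n, NotLimit z n := by
  by_contra h
  push Not at h
  exact Omega.succ_ne_zero 0 (limit_unique (h _) (h _))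

/-- A sequence enumerating the sets `{n | z t ≠ n for some t ≥ k}`. -/
noncomputable def nonLimits (z : Baire M) : Baire M :=
  lam fun i => Omega.mu fun v => ∃ n, v = n.succ ∧ ∃ k t, i = pair k (pair n t) ∧ k ≤ t ∧ z t ≠ n

instance dfun_nonLimits : DFun M (nonLimits (M := M)) := by
  have : DFun M fun z : Baire M => lam fun i => Omega.mu fun v => ∃ n, v = n.succ ∧
    ∃ k t, i = pair k (pair n t) ∧ k ≤ t ∧ z t ≠ n := inferInstance
  exact this

theorem nonLimits_app (z : Baire M) (i : Omega M) : nonLimits z i = Omega.mu fun v =>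
    ∃ n, v = n.succ ∧ ∃ k t, i = pair k (pair n t) ∧ k ≤ t ∧ z t ≠ n :=
  lam_app _ i

/-- The default value `0` of `mu` agrees with the convention that `0` enumerates nothing, so one
formula describes both the enumerating and the idle entries. -/
theorem mu_succ_iff {P : Omega M → Prop} (hP : ∀ a b, P a → P b → a = b) {n : Omega M} :
    (Omega.mu fun v => ∃ n, v = n.succ ∧ P n) = n.succ ↔ P n := by
  constructor
  · intro h
    rcases Omega.mu_eq_iff.1 h with ⟨⟨m, hm, hP⟩, -⟩ | ⟨-, h⟩
    · rwa [Omega.succ_inj.1 hm]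
    · exact (Omega.succ_ne_zero _ h).elim
  · intro h
    refine Omega.mu_eq_of_unique ⟨n, rfl, h⟩ ?_
    rintro k ⟨m, rfl, hm⟩
    rw [hP m n hm h]

theorem nonLimits_iff {z : Baire M} {i n : Omega M} : nonLimits z i = n.succ ↔
    ∃ k t, i = pair k (pair n t) ∧ k ≤ t ∧ z t ≠ n := by
  rw [nonLimits_app]
  refine mu_succ_iff (P := fun n => ∃ k t, i = pair k (pair n t) ∧ k ≤ t ∧ z t ≠ n) ?_
  rintro a b ⟨k, t, rfl, -⟩ ⟨k', t', h, -⟩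
  exact (pair_inj.1 (pair_inj.1 h).2).1

theorem inInter_nonLimits {z : Baire M} {n : Omega M} :
    InInter (nonLimits z) n ↔ NotLimit z n := by
  simp only [InInter, nonLimits_iff, NotLimit, not_exists, not_forall, exists_prop]
  constructor
  · intro h s
    obtain ⟨j, k, t, hj, hk, ht⟩ := h s
    rw [(pair_inj.1 hj).1]
    exact ⟨t, hk, ht⟩
  · intro h k
    obtain ⟨t, hk, ht⟩ := h k
    exact ⟨_, k, t, rfl, hk, ht⟩

theorem red_notLimit_pi2Choice : Red (M := M) NotLimit (onZero Pi2Choice) := by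
  have hP : ∀ z : Baire M, ∀ q, onZero Pi2Choice (nonLimits z) q ↔ NotLimit z (q 0) := fun z q =>
    ⟨fun h => inInter_nonLimits.1 h.2, fun h => ⟨fun a b ha hb =>
      limit_unique (fun h => ha (inInter_nonLimits.2 h)) fun h => hb (inInter_nonLimits.2 h),
      inInter_nonLimits.2 h⟩⟩
  refine ⟨nonLimits, fun _ q => q 0, inferInstance, inferInstance, fun p _ n => ?_,
    fun p q _ _ => ⟨Omega.succ 0, fun p' q' _ _ _ h => h 0 (Omega.lt_succ_self 0)⟩,
    fun p _ => ⟨?_, fun q hq => (hP p q).1 hq⟩⟩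
  -- The entry at index `⟨k, ⟨a, t⟩⟩` reads the sequence only at `t`; any other entry would not read
  -- it at all.
  · by_cases h : ∃ k a t : Omega M, n = pair k (pair a t)
    · obtain ⟨k, a, t, rfl⟩ := h
      refine ⟨t.succ, fun p' _ ha => ?_⟩
      rw [nonLimits_app, nonLimits_app]
      congr 1
      funext v
      refine propext (exists_congr fun m => and_congr_right fun _ => exists_congr fun k' =>
        exists_congr fun t' => and_congr_right fun h => ?_)
      obtain ⟨-, h⟩ := pair_inj.1 h
      obtain ⟨-, rfl⟩ := pair_inj.1 h
      rw [ha t t.lt_succ_self]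
    · refine ⟨0, fun p' _ _ => ?_⟩
      rw [nonLimits_app, nonLimits_app]
      congr 1
      funext v
      refine propext (exists_congr fun m => and_congr_right fun _ => exists_congr fun k' =>
        exists_congr fun t' => and_congr_right fun h' => (h ⟨_, _, _, h'⟩).elim)
  · obtain ⟨n, hn⟩ := exists_notLimit p
    exact ⟨const n, (hP p _).2 (by rwa [const_app])⟩

/-- Monotonicity allows taking maxima, but `N` may be nonstandard, so the maximum is formed by
induction inside the model. -/
theorem bounding {Q : Omega M → Omega M → Prop} (dQ : Dfn M fun e : Omega M × Omega M => Q e.1 e.2)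
    (mono : ∀ c s t, s ≤ t → Q c s → Q c t) (N : Omega M) (h : ∀ c, c < N → ∃ s, Q c s) :
    ∃ s, ∀ c, c < N → Q c s := by
  have hQ : ∀ {E : Type u} [Coded M E] (t : E → Omega M) (s : E → Omega M) [DFun M t] [DFun M s],
    Dfn M fun e => Q (t e) (s e) := fun t s => Dfn.comp₂ dQ t s
  refine Omega.induction (P := fun n => n ≤ N → ∃ s, ∀ c, c < n → Q c s) inferInstance
    (fun _ => ⟨0, fun c hc => (Omega.not_lt_zero c hc).elim⟩) (fun n ih hn => ?_) N le_rfl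
  rw [Omega.succ_le_iff] at hn
  obtain ⟨s, hs⟩ := ih hn.le
  obtain ⟨t, ht⟩ := h n hn
  refine ⟨max s t, fun c hc => ?_⟩
  rcases (Omega.lt_succ_iff.1 hc).lt_or_eq with hc | rfl
  · exact mono _ _ _ (le_max_left _ _) (hs c hc)
  · exact mono _ _ _ (le_max_right _ _) ht

/-- The pair `c = ⟨n, k⟩` seems at stage `s` to witness that `n` is not in the `k`-th set. -/
def Candidate (p : Baire M) (s c : Omega M) : Prop :=
  ∃ n k, c = pair n k ∧ ∀ i, i < s → ∀ j, i = pair k j → p i ≠ n.succ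

instance dfn_candidate {X : Type u} [Coded M X] (f : X → Baire M) (g h : X → Omega M)
    [DFun M f] [DFun M g] [DFun M h] : Dfn M fun x => Candidate (f x) (g x) (h x) := by
  have hf : ∀ {E : Type u} [Coded M E] (t : E → X) [DFun M t], DFun M fun e => f (t e) :=
    fun t => DFun.comp f t
  have hg : ∀ {E : Type u} [Coded M E] (t : E → X) [DFun M t], DFun M fun e => g (t e) :=
    fun t => DFun.comp g t
  have hh : ∀ {E : Type u} [Coded M E] (t : E → X) [DFun M t], DFun M fun e => h (t e) :=
    fun t => DFun.comp h t
  unfold Candidate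
  infer_instance

theorem Candidate.congr {p p' : Baire M} {s c : Omega M} (h : Candidate p s c)
    (ha : AgreeBelow s p p') : Candidate p' s c := by
  obtain ⟨n, k, hc, h⟩ := h
  exact ⟨n, k, hc, fun i hi j hj => ha i hi ▸ h i hi j hj⟩

theorem Candidate.anti {p : Baire M} {s t c : Omega M} (h : Candidate p t c) (hs : s ≤ t) :
    Candidate p s c := by
  obtain ⟨n, k, hc, h⟩ := h
  exact ⟨n, k, hc, fun i hi j hj => h i (hi.trans_le hs) j hj⟩

/-- The sequence of the first components of the least candidates. -/
noncomputable def guesses (p : Baire M) : Baire M :=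
  lam fun s => Omega.mu fun n => ∃ k, Candidate p s (pair n k) ∧
    ∀ c, c < pair n k → ¬ Candidate p s c

instance dfun_guesses : DFun M (guesses (M := M)) := by
  have : DFun M fun p : Baire M => lam fun s => Omega.mu fun n => ∃ k, Candidate p s (pair n k) ∧
    ∀ c, c < pair n k → ¬ Candidate p s c := inferInstance
  exact this

theorem guesses_app (p : Baire M) (s : Omega M) : guesses p s = Omega.mu fun n =>
    ∃ k, Candidate p s (pair n k) ∧ ∀ c, c < pair n k → ¬ Candidate p s c :=
  lam_app _ s

/-- A missing `n` yields a pair that stays a candidate forever. The least permanent candidate also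
has a missing first component, which is `n` by uniqueness. All smaller pairs are refuted by one
common stage, and from then on the guess is `n`. -/
theorem not_notLimit_guesses {p : Baire M} {n : Omega M}
    (hu : ∀ a b, ¬ InInter p a → ¬ InInter p b → a = b) (hn : ¬ InInter p n) :
    ¬ NotLimit (guesses p) n := by
  -- Stage `⟨k, j⟩ + 1` is the first that inspects the entry at index `⟨k, j⟩`.
  have key : ∀ n k : Omega M, (∀ j, p (pair k j) ≠ n.succ) ↔ ∀ s, Candidate p s (pair n k) := by
    intro n k
    constructor
    · intro h s
      exact ⟨n, k, rfl, fun i _ j hj => hj ▸ h j⟩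
    · intro h j hj
      obtain ⟨n', k', he, h'⟩ := h (pair k j).succ
      obtain ⟨rfl, rfl⟩ := pair_inj.1 he
      exact h' _ (Omega.lt_succ_self _) j rfl hj
  have hn' := hn
  simp only [InInter, not_forall, not_exists] at hn
  obtain ⟨k, hk⟩ := hn
  obtain ⟨c, hc, hlt⟩ := Omega.exists_least (P := fun c => ∀ s, Candidate p s c) inferInstance
    ⟨_, (key n k).1 hk⟩
  obtain ⟨m, l, rfl, -⟩ := hc 0
  obtain rfl : m = n := hu _ _ (fun h => by
    obtain ⟨j, hj⟩ := h l
    exact (key m l).2 hc j hj) hn'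
  obtain ⟨s, hs⟩ := bounding (Q := fun c s => ¬ Candidate p s c) inferInstance
    (fun c s t hst h h' => h (h'.anti hst)) (pair m l) fun c hc => not_forall.1 (hlt c hc)
  rw [NotLimit, not_not]
  refine ⟨s, fun t ht => ?_⟩
  rw [guesses_app]
  refine Omega.mu_eq_of_unique ⟨l, hc t, fun c hc h => hs c hc (h.anti ht)⟩ ?_
  rintro a ⟨b, hab, hab'⟩
  rcases lt_trichotomy (pair a b) (pair m l) with h | h | h
  · exact (hs _ h (hab.anti ht)).elim
  · exact (pair_inj.1 h).1
  · exact (hab' _ h (hc t)).elim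

theorem red_pi2Choice_notLimit : Red (M := M) Pi2Choice (onZero NotLimit) := by
  refine ⟨guesses, fun _ q => q 0, inferInstance, inferInstance, fun p _ n => ⟨n, fun p' _ ha => ?_⟩,
    fun p q _ _ => ⟨Omega.succ 0, fun p' q' _ _ _ h => h 0 (Omega.lt_succ_self 0)⟩,
    fun p hp => ⟨?_, fun q hq => ?_⟩⟩
  · have : ∀ c, Candidate p n c ↔ Candidate p' n c := fun c => ⟨fun h => h.congr ha,
      fun h => h.congr ha.symm⟩
    simp only [guesses_app, this]
  · obtain ⟨n, hn⟩ := exists_notLimit (guesses p)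
    exact ⟨const n, by rwa [onZero, const_app]⟩
  · obtain ⟨_, hu, -⟩ := hp
    exact ⟨hu, by_contra fun h => not_notLimit_guesses hu h hq⟩

/-! ### Avoiding limits is not reducible to closed choice -/

/-- The Baire category theorem: a sequence meeting countably many dense open sets. -/
theorem exists_generic {D : Omega M → Omega M → Prop}
    (dD : Dfn M fun e : Omega M × Omega M => D e.1 e.2)
    (dense : ∀ n z m, ∃ z' m', m ≤ m' ∧ AgreeBelow m z z' ∧ D n (res z' m')) :
    ∃ z, ∀ n, ∃ m, D n (res z m) := by
  have hD : ∀ {E : Type u} [Coded M E] (t : E → Omega M) (s : E → Omega M) [DFun M t] [DFun M s],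
    Dfn M fun e => D (t e) (s e) := fun t s => Dfn.comp₂ dD t s
  -- Prefixes are represented by numbers, so `mu` selects the next one and no choice is needed.
  -- Requiring `m < m'` makes the lengths unbounded.
  obtain ⟨s, hs0, hs⟩ := exists_rec (M := M) 0 (fun n c => Omega.mu fun c' => ∃ z m z' m',
    c = res z m ∧ c' = res z' m' ∧ m < m' ∧ AgreeBelow m z z' ∧ D n c') inferInstance
  have step : ∀ n z m, s n = res z m →
      ∃ z' m', s n.succ = res z' m' ∧ m < m' ∧ AgreeBelow m z z' ∧ D n (res z' m') := by
    intro n z m h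
    obtain ⟨z₁, m₁, hm₁, ha₁, hD₁⟩ := dense n z m.succ
    have := (Omega.mu_spec (P := fun c' => ∃ z m z' m', s n = res z m ∧ c' = res z' m' ∧ m < m' ∧
      AgreeBelow m z z' ∧ D n c') inferInstance ⟨_, z, m, z₁, m₁, h, rfl,
        Omega.succ_le_iff.1 hm₁, ha₁.mono m.le_succ, hD₁⟩).1
    rw [← hs] at this
    obtain ⟨z₂, m₂, z', m', h2, h', hlt, ha, hd⟩ := this
    obtain ⟨rfl, ha'⟩ := res_eq_iff.1 (h.symm.trans h2)
    exact ⟨z', m', h', hlt, ha'.trans ha, h' ▸ hd⟩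
  have code : ∀ n, ∃ z m, s n = res z m := by
    refine Omega.induction inferInstance ⟨default, 0, by rw [hs0, res_zero]⟩ fun n ih => ?_
    obtain ⟨z, m, h⟩ := ih
    obtain ⟨z', m', h', -⟩ := step n z m h
    exact ⟨z', m', h'⟩
  have coherent : ∀ n k, k ≤ n → ∀ z m z' m', s k = res z m → s n = res z' m' →
      m ≤ m' ∧ AgreeBelow m z z' := by
    refine Omega.induction inferInstance (fun k hk z m z' m' h h' => ?_)
      fun n ih k hk z m z' m' h h' => ?_
    · obtain rfl := hk.antisymm (Omega.zero_le k)
      obtain ⟨rfl, ha⟩ := res_eq_iff.1 (h.symm.trans h')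
      exact ⟨le_rfl, ha⟩
    · rcases hk.lt_or_eq with hk | rfl
      · obtain ⟨z₁, m₁, h1⟩ := code n
        obtain ⟨hm, ha⟩ := ih k (Omega.lt_succ_iff.1 hk) z m z₁ m₁ h h1
        obtain ⟨z₂, m₂, h2, hm2, ha2, -⟩ := step n z₁ m₁ h1
        obtain ⟨rfl, ha3⟩ := res_eq_iff.1 (h2.symm.trans h')
        exact ⟨hm.trans hm2.le, (ha.trans (ha2.mono hm)).trans (ha3.mono (hm.trans hm2.le))⟩
      · obtain ⟨rfl, ha⟩ := res_eq_iff.1 (h.symm.trans h')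
        exact ⟨le_rfl, ha⟩
  have length : ∀ n z m, s n = res z m → n ≤ m := by
    refine Omega.induction inferInstance (fun _ _ _ => Omega.zero_le _) fun n ih z m h => ?_
    obtain ⟨z₁, m₁, h1⟩ := code n
    obtain ⟨z₂, m₂, h2, hm2, -⟩ := step n z₁ m₁ h1
    obtain ⟨rfl, -⟩ := res_eq_iff.1 (h2.symm.trans h)
    exact Omega.succ_le_iff.2 ((ih z₁ m₁ h1).trans_lt hm2)
  -- The prefix of stage `k + 1` has length at least `k + 1`, so it determines the value at `k`.
  let w : Baire M := lam fun k => Omega.mu fun v => ∃ z m, s k.succ = res z m ∧ v = z k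
  have hw : ∀ n z m, s n = res z m → AgreeBelow m w z := by
    intro n z m h k hk
    have e : w k = Omega.mu fun v => ∃ z m, s k.succ = res z m ∧ v = z k := lam_app _ k
    obtain ⟨z₁, m₁, h1⟩ := code k.succ
    have hk1 : k < m₁ := Omega.succ_le_iff.1 (length _ _ _ h1)
    rw [e]
    refine (Omega.mu_eq_of_unique (n := z₁ k) ⟨z₁, m₁, h1, rfl⟩ ?_).trans ?_
    · rintro _ ⟨z₂, m₂, h2, rfl⟩
      obtain ⟨rfl, ha⟩ := res_eq_iff.1 (h1.symm.trans h2)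
      exact (ha k hk1).symm
    · rcases le_total n k.succ with hle | hle
      · exact ((coherent _ _ hle z m z₁ m₁ h h1).2 k hk).symm
      · exact (coherent _ _ hle z₁ m₁ z m h1 h).2 k hk1
  refine ⟨w, fun n => ?_⟩
  obtain ⟨z, m, h⟩ := code n
  obtain ⟨z', m', h', -, -, hd⟩ := step n z m h
  refine ⟨m', ?_⟩
  rwa [res_eq_iff.2 ⟨rfl, hw _ _ _ h'⟩]

/-- If every number can be forced into the enumeration `H z` by extending any prefix, a generic `z`
makes `H z` enumerate everything, leaving no solution. Otherwise some prefix forces a number `n`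
never to be enumerated, so `n` is a correct answer for all extensions. By continuity `K` then gives
one fixed value on a longer prefix, and an extension converging to this value refutes the reduction.
-/
theorem not_red_notLimit : ¬ Red (M := M) NotLimit (onZero Unenumerated) := by
  rintro ⟨H, K, dH, dK, cH, cK, h⟩
  have dH' : ∀ {E : Type u} [Coded M E] (t : E → Baire M) [DFun M t], DFun M fun e => H (t e) :=
    fun t => DFun.comp H t
  have dom := exists_notLimit (M := M)
  by_cases dense : ∀ (z : Baire M) (m n : Omega M), ∃ z' : Baire M, AgreeBelow m z z' ∧ ∃ i, H z' i = n.succ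
  · obtain ⟨z, hz⟩ := exists_generic (M := M) (D := fun n c => ∃ z m, c = res z m ∧
      ∀ z', AgreeBelow m z z' → ∃ i, H z' i = n.succ) inferInstance fun n z m => by
        obtain ⟨z', ha, i, hi⟩ := dense z m n
        obtain ⟨k, hk⟩ := cH z' (dom z') i
        exact ⟨z', max m k, le_max_left _ _, ha, z', max m k, rfl, fun z'' ha' =>
          ⟨i, (hk z'' (dom z'') (ha'.mono (le_max_right _ _))).symm.trans hi⟩⟩
    obtain ⟨q, hq⟩ := (h z (dom z)).1
    obtain ⟨m, z', m', he, hz'⟩ := hz (q 0)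
    obtain ⟨rfl, ha⟩ := res_eq_iff.1 he
    exact hq (hz' z ha.symm)
  · push Not at dense
    obtain ⟨z, m, n, hn⟩ := dense
    have hq : ∀ z', AgreeBelow m z z' → onZero Unenumerated (H z') (const n) := by
      rintro z' ha ⟨i, hi⟩
      rw [const_app] at hi
      exact hn z' ha i hi
    obtain ⟨k, hk⟩ := cK z (const n) (dom z) (hq z (AgreeBelow.refl _ _))
    classical
    -- Up to `m` to keep `n` correct, up to `k` to fix the output of `K`; afterwards `w` repeats
    -- that output.
    let w : Baire M := lam fun t => if t < max m k then z t else K z (const n)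
    have hw : ∀ t, w t = if t < max m k then z t else K z (const n) := fun t => lam_app _ t
    have ha : AgreeBelow (max m k) z w := fun t ht => by rw [hw, if_pos ht]
    have hqw := hq w (ha.mono (le_max_left _ _))
    have hK := (h w (dom w)).2 _ hqw
    rw [← hk w (const n) (dom w) hqw (ha.mono (le_max_right _ _)) (AgreeBelow.refl _ _)] at hK
    exact hK ⟨max m k, fun t ht => by rw [hw, if_neg ht.not_gt]⟩

end Problems

section FirstOrderPart

variable {M : Type u} [SetStructure M] [ZFModel M]

/-! ### The game -/

/-- The winning strategy of player I is the forward map, and solutions are returned unchanged. -/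
theorem red_of_strategy {F : Baire M → Omega M → Prop} {S : Baire M → Baire M} (dS : DFun M S)
    (cS : ∀ y y' n, AgreeBelow n y y' → S y n = S y' n)
    (hS : ∀ y, (∃ n, F (S y) n) ∧ ∀ n, F (S y) n → NotLimit y n) : Red NotLimit (onZero F) := by
  refine ⟨S, fun _ q => q 0, dS, inferInstance, fun p _ n => ⟨n, fun p' _ ha => cS _ _ _ ha⟩,
    fun p q _ _ => ⟨Omega.succ 0, fun p' q' _ _ _ h => h 0 (Omega.lt_succ_self 0)⟩,
    fun p _ => ⟨?_, fun q hq => (hS p).2 _ hq⟩⟩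
  obtain ⟨n, hn⟩ := (hS p).1
  exact ⟨const n, by rwa [onZero, const_app]⟩

/-- An enumeration of the numbers `s` at which `y` has not yet reached its limit. -/
noncomputable def changes (y : Baire M) : Baire M :=
  lam fun i => Omega.mu fun v => ∃ s, v = s.succ ∧ ∃ t, i = pair s t ∧ s ≤ t ∧ y t ≠ y s

instance dfun_changes {X : Type u} [Coded M X] (f : X → Baire M) [DFun M f] :
    DFun M fun x => changes (f x) := by
  have : DFun M (changes (M := M)) :=
    (inferInstance : DFun M fun y : Baire M => lam fun i => Omega.mu fun v => ∃ s, v = s.succ ∧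
      ∃ t, i = pair s t ∧ s ≤ t ∧ y t ≠ y s)
  exact DFun.comp changes f

theorem changes_app (y : Baire M) (i : Omega M) : changes y i = Omega.mu fun v =>
    ∃ s, v = s.succ ∧ ∃ t, i = pair s t ∧ s ≤ t ∧ y t ≠ y s :=
  lam_app _ i

theorem unenumerated_changes {y : Baire M} {s : Omega M} :
    Unenumerated (changes y) s ↔ ∀ t, s ≤ t → y t = y s := by
  have : ∀ i, changes y i = s.succ ↔ ∃ t, i = pair s t ∧ s ≤ t ∧ y t ≠ y s := fun i => by
    rw [changes_app]
    refine mu_succ_iff (P := fun s => ∃ t, i = pair s t ∧ s ≤ t ∧ y t ≠ y s) ?_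
    rintro a b ⟨t, rfl, -⟩ ⟨t', h, -⟩
    exact (pair_inj.1 h).1
  simp only [Unenumerated, this]
  constructor
  · intro h t ht
    by_contra hne
    exact h ⟨_, t, rfl, ht, hne⟩
  · rintro h ⟨i, t, -, ht, hne⟩
    exact hne (h t ht)

theorem changes_congr {y y' : Baire M} {i : Omega M}
    (h : ∀ s t, i = pair s t → y s = y' s ∧ y t = y' t) : changes y i = changes y' i := by
  rw [changes_app, changes_app]
  congr 1
  funext v
  refine propext (exists_congr fun s => and_congr_right fun _ => exists_congr fun t =>
    and_congr_right fun hi => ?_)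
  rw [(h s t hi).1, (h s t hi).2]

/-- The strategy of player II makes `T x` converge to a solution. Closed choice applied to `changes
(T x)` returns a stage from which `T x` is constant, and the value there is the solution. -/
theorem red_unenumerated_of_strategy {F : Baire M → Omega M → Prop} {T : Baire M → Baire M}
    (dT : DFun M T) (cT : ∀ x x' n, AgreeBelow n.succ x x' → T x n = T x' n)
    (hT : ∀ x, (∃ n, F x n) → ∃ n, F x n ∧ ¬ NotLimit (T x) n) : Red F (onZero Unenumerated) := by
  have dT' : ∀ {E : Type u} [Coded M E] (t : E → Baire M) [DFun M t], DFun M fun e => T (t e) :=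
    fun t => DFun.comp T t
  refine ⟨fun x => changes (T x), fun x q => T x (q 0), inferInstance, inferInstance,
    fun p _ n => ?_, fun p q _ _ => ⟨max (Omega.succ 0) (q 0).succ, fun p' q' _ _ ha ha' => ?_⟩,
    fun p hp => ⟨?_, fun q hq => ?_⟩⟩
  · by_cases h : ∃ s t : Omega M, n = pair s t
    · obtain ⟨s, t, rfl⟩ := h
      refine ⟨max s.succ t.succ, fun p' _ ha => changes_congr fun s' t' h => ?_⟩
      obtain ⟨rfl, rfl⟩ := pair_inj.1 h
      exact ⟨cT _ _ _ (ha.mono (le_max_left _ _)), cT _ _ _ (ha.mono (le_max_right _ _))⟩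
    · exact ⟨0, fun p' _ _ => changes_congr fun s t hst => (h ⟨s, t, hst⟩).elim⟩
  · dsimp only
    rw [← ha'.mono (le_max_left _ _) 0 (Omega.lt_succ_self 0)]
    exact cT _ _ _ (ha.mono (le_max_right _ _))
  · obtain ⟨n, -, hn⟩ := hT p hp
    obtain ⟨s, hs⟩ := not_not.1 hn
    refine ⟨const s, ?_⟩
    rw [onZero, const_app, unenumerated_changes]
    exact fun t ht => (hs t ht).trans (hs s le_rfl).symm
  · obtain ⟨n, hF, hn⟩ := hT p hp
    obtain ⟨s, hs⟩ := not_not.1 hn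
    have hq' := unenumerated_changes.1 hq
    dsimp only
    -- The values of `T x` at the returned stage `q 0` and at the true stage `s` are compared at the
    -- maximum of both.
    rwa [← hq' _ (le_max_left (q 0) s), hs _ (le_max_right (q 0) s)]

/-- Player I must produce an instance of `F`, and player II must converge to one of its solutions.
The two kinds of winning strategies are the two reductions. -/
theorem dichotomy (hAD : AD M) {F : Baire M → Omega M → Prop}
    (dF : Dfn M fun e : Baire M × Omega M => F e.1 e.2) :
    Red F (onZero Unenumerated) ∨ Red NotLimit (onZero F) := by
  have hF : ∀ {E : Type u} [Coded M E] (t : E → Baire M) (s : E → Omega M) [DFun M t] [DFun M s],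
    Dfn M fun e => F (t e) (s e) := fun t s => Dfn.comp₂ dF t s
  rcases determinacy hAD (fun x y => (∃ n, F x n) ∧ ∀ n, F x n → NotLimit y n) inferInstance with
    ⟨S, dS, cS, hS⟩ | ⟨T, dT, cT, hT⟩
  · exact Or.inr (red_of_strategy dS cS hS)
  · refine Or.inl (red_unenumerated_of_strategy dT cT fun x hx => ?_)
    have := hT x
    push Not at this
    exact this hx

/-! ### The first-order part -/

/-- The first half of the sequence `r`. -/
noncomputable def left (r : Baire M) : Baire M := lam fun j => r (pair 0 j)

/-- The second half of the sequence `r`. -/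
noncomputable def right (r : Baire M) : Baire M := lam fun j => r (pair (Omega.succ 0) j)

instance dfun_left {X : Type u} [Coded M X] (f : X → Baire M) [DFun M f] :
    DFun M fun x => left (f x) := by
  have : DFun M (left (M := M)) :=
    (inferInstance : DFun M fun r : Baire M => lam fun j => r (pair 0 j))
  exact DFun.comp left f

instance dfun_left_self : DFun M (left (M := M)) := dfun_left fun r => r

instance dfun_right {X : Type u} [Coded M X] (f : X → Baire M) [DFun M f] :
    DFun M fun x => right (f x) := by
  have : DFun M (right (M := M)) :=
    (inferInstance : DFun M fun r : Baire M => lam fun j => r (pair (Omega.succ 0) j))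
  exact DFun.comp right f

theorem left_app (r : Baire M) (j : Omega M) : left r j = r (pair 0 j) := lam_app _ j

theorem right_app (r : Baire M) (j : Omega M) : right r j = r (pair (Omega.succ 0) j) :=
  lam_app _ j

/-- The sequence with given halves. -/
noncomputable def join (p k : Baire M) : Baire M :=
  lam fun i => Omega.mu fun v => ∃ j, i = pair 0 j ∧ v = p j ∨ i = pair (Omega.succ 0) j ∧ v = k j

instance dfun_join {X : Type u} [Coded M X] (f g : X → Baire M) [DFun M f] [DFun M g] :
    DFun M fun x => join (f x) (g x) := by
  have : DFun M fun e : Baire M × Baire M => lam fun i => Omega.mu fun v =>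
    ∃ j, i = pair 0 j ∧ v = e.1 j ∨ i = pair (Omega.succ 0) j ∧ v = e.2 j := inferInstance
  exact DFun.comp₂ (h := join) this f g

theorem join_app (p k : Baire M) (i : Omega M) : join p k i = Omega.mu fun v =>
    ∃ j, i = pair 0 j ∧ v = p j ∨ i = pair (Omega.succ 0) j ∧ v = k j :=
  lam_app _ i

theorem join_app_left (p k : Baire M) (j : Omega M) : join p k (pair 0 j) = p j := by
  rw [join_app]
  refine Omega.mu_eq_of_unique ⟨j, Or.inl ⟨rfl, rfl⟩⟩ ?_
  rintro _ ⟨j', ⟨h, rfl⟩ | ⟨h, rfl⟩⟩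
  · rw [(pair_inj.1 h).2]
  · exact (Omega.succ_ne_zero _ (pair_inj.1 h).1.symm).elim

theorem join_app_right (p k : Baire M) (j : Omega M) :
    join p k (pair (Omega.succ 0) j) = k j := by
  rw [join_app]
  refine Omega.mu_eq_of_unique ⟨j, Or.inr ⟨rfl, rfl⟩⟩ ?_
  rintro _ ⟨j', ⟨h, rfl⟩ | ⟨h, rfl⟩⟩
  · exact (Omega.succ_ne_zero _ (pair_inj.1 h).1).elim
  · rw [(pair_inj.1 h).2]

theorem left_join (p k : Baire M) : left (join p k) = p :=
  Baire.ext fun j => by rw [left_app, join_app_left]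

theorem right_join (p k : Baire M) : right (join p k) = k :=
  Baire.ext fun j => by rw [right_app, join_app_right]

/-- `n` is the value at `q` of the partial continuous function coded by `k`. -/
def CodedValue (k q : Baire M) (n : Omega M) : Prop :=
  ∃ m, k (res q m) = n.succ ∧ ∀ l, l < m → k (res q l) = 0

instance dfn_codedValue {X : Type u} [Coded M X] (f g : X → Baire M) (h : X → Omega M)
    [DFun M f] [DFun M g] [DFun M h] : Dfn M fun x => CodedValue (f x) (g x) (h x) := by
  have hf : ∀ {E : Type u} [Coded M E] (t : E → X) [DFun M t], DFun M fun e => f (t e) :=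
    fun t => DFun.comp f t
  have hg : ∀ {E : Type u} [Coded M E] (t : E → X) [DFun M t], DFun M fun e => g (t e) :=
    fun t => DFun.comp g t
  have hh : ∀ {E : Type u} [Coded M E] (t : E → X) [DFun M t], DFun M fun e => h (t e) :=
    fun t => DFun.comp h t
  unfold CodedValue
  infer_instance

theorem CodedValue.unique {k q : Baire M} {n n' : Omega M} (h : CodedValue k q n)
    (h' : CodedValue k q n') : n = n' := by
  obtain ⟨m, hm, hl⟩ := h
  obtain ⟨m', hm', hl'⟩ := h'
  rcases lt_trichotomy m m' with hlt | rfl | hlt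
  · exact (Omega.succ_ne_zero _ (hm.symm.trans (hl' m hlt))).elim
  · exact Omega.succ_injective (hm.symm.trans hm')
  · exact (Omega.succ_ne_zero _ (hm'.symm.trans (hl m' hlt))).elim

/-- The universal first-order problem below `G`: an instance consists of an instance of `G` and
a code of a partial continuous function that is defined on all its solutions; a solution is the
value of that function at one of them. -/
def Universal (G : Baire M → Baire M → Prop) (r : Baire M) (n : Omega M) : Prop :=
  (∀ q, G (left r) q → ∃ n, CodedValue (right r) q n) ∧
    ∃ q, G (left r) q ∧ CodedValue (right r) q n

variable {G : Baire M → Baire M → Prop}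

theorem dfn_universal (dG : Dfn M fun e : Baire M × Baire M => G e.1 e.2) :
    Dfn M fun e : Baire M × Omega M => Universal G e.1 e.2 := by
  have hG : ∀ {E : Type u} [Coded M E] (t s : E → Baire M) [DFun M t] [DFun M s],
    Dfn M fun e => G (t e) (s e) := fun t s => Dfn.comp₂ dG t s
  unfold Universal
  infer_instance

/-- The left half is passed to `G`, and the code in the right half is evaluated at the solution. -/
theorem red_universal : Red (Universal G) G := by
  have hmu : ∀ (r q : Baire M) (n : Omega M), CodedValue (right r) q n →
      (Omega.mu fun n => CodedValue (right r) q n) = n :=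
    fun r q n h => Omega.mu_eq_of_unique h fun k hk => hk.unique h
  refine ⟨fun r => left r, fun r q => Omega.mu fun n => CodedValue (right r) q n, inferInstance,
    inferInstance, fun r _ n => ⟨(pair 0 n).succ, fun r' _ ha => ?_⟩, fun r q hr hq => ?_,
    fun r hr => ⟨?_, fun q hq => ?_⟩⟩
  · rw [left_app, left_app, ha _ (Omega.lt_succ_self _)]
  · obtain ⟨_, hr, -⟩ := hr
    obtain ⟨n, hn⟩ := hr q hq
    simp only [hmu r q n hn]
    obtain ⟨m, hm, hl⟩ := hn
    -- Evaluation reads the code only at the prefixes of `q` of length at most `m`; `b` bounds their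
    -- positions in `r`.
    obtain ⟨b, hb⟩ := bounding (Q := fun l b => pair (Omega.succ 0) (res q l) < b) inferInstance
      (fun l s t hst h => h.trans_le hst) m.succ fun l _ => ⟨_, Omega.lt_succ_self _⟩
    refine ⟨max b m, fun r' q' _ _ ha ha' => (hmu r' q' n ⟨m, ?_, fun l hl' => ?_⟩).symm⟩
    · rw [← res_eq_iff.2 ⟨rfl, ha'.mono (le_max_right _ _)⟩, right_app,
        ← ha _ ((hb m m.lt_succ_self).trans_le (le_max_left _ _)), ← right_app, hm]
    · rw [← res_eq_iff.2 ⟨rfl, ha'.mono (hl'.le.trans (le_max_right _ _))⟩, right_app,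
        ← ha _ ((hb l (hl'.trans m.lt_succ_self)).trans_le (le_max_left _ _)), ← right_app, hl l hl']
  · obtain ⟨_, _, q, hq, -⟩ := hr
    exact ⟨q, hq⟩
  · obtain ⟨_, hr, -⟩ := hr
    obtain ⟨n, hn⟩ := hr q hq
    dsimp only
    rw [hmu r q n hn]
    exact ⟨hr, q, hq, hn⟩

/-- The task is to code `K p` by a sequence depending continuously on `p`. In a code, `0` means that
a prefix does not yet decide the value and `n + 1` means that the value is `n`. -/
theorem Red.to_universal (dG : Dfn M fun e : Baire M × Baire M => G e.1 e.2)
    {F : Baire M → Omega M → Prop} (dF : Dfn M fun e : Baire M × Omega M => F e.1 e.2)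
    (h : Red F G) : Red F (onZero (Universal G)) := by
  obtain ⟨H, K, dH, dK, cH, cK, h⟩ := h
  have hF : ∀ {E : Type u} [Coded M E] (t : E → Baire M) (s : E → Omega M) [DFun M t] [DFun M s],
    Dfn M fun e => F (t e) (s e) := fun t s => Dfn.comp₂ dF t s
  have hG : ∀ {E : Type u} [Coded M E] (t s : E → Baire M) [DFun M t] [DFun M s],
    Dfn M fun e => G (t e) (s e) := fun t s => Dfn.comp₂ dG t s
  have dH' : ∀ {E : Type u} [Coded M E] (t : E → Baire M) [DFun M t], DFun M fun e => H (t e) :=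
    fun t => DFun.comp H t
  have dK' : ∀ {E : Type u} [Coded M E] (t s : E → Baire M) [DFun M t] [DFun M s],
    DFun M fun e => K (t e) (s e) := fun t s => DFun.comp₂ dK t s
  -- A prefix `c` of length `m` decides `n` if `K` has the value `n` on all admissible pairs
  -- extending `c` and the first `m` entries of `p`. Using only `m` entries of `p` gives continuity
  -- in `p` without choosing moduli; requiring one such pair makes `n` unique.
  let W : Baire M → Omega M → Omega M → Prop := fun p c n => ∃ m,
    (∃ p' q', (∃ n, F p' n) ∧ G (H p') q' ∧ AgreeBelow m p p' ∧ c = res q' m) ∧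
    ∀ p' q', (∃ n, F p' n) ∧ G (H p') q' ∧ AgreeBelow m p p' ∧ c = res q' m → K p' q' = n
  have dW : ∀ {E : Type u} [Coded M E] (t : E → Baire M) (s r : E → Omega M) [DFun M t] [DFun M s]
      [DFun M r], Dfn M fun e => W (t e) (s e) (r e) := by
    intro E _ t s r _ _ _
    have ht : ∀ {E' : Type u} [Coded M E'] (i : E' → E) [DFun M i], DFun M fun e => t (i e) :=
      fun i => DFun.comp t i
    have hs : ∀ {E' : Type u} [Coded M E'] (i : E' → E) [DFun M i], DFun M fun e => s (i e) :=
      fun i => DFun.comp s i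
    have hr : ∀ {E' : Type u} [Coded M E'] (i : E' → E) [DFun M i], DFun M fun e => r (i e) :=
      fun i => DFun.comp r i
    simp only [W]
    infer_instance
  have W_unique : ∀ p c n n', W p c n → W p c n' → n = n' := by
    rintro p c n n' ⟨m, ⟨p₁, q₁, h1, h2, h3, rfl⟩, hn⟩ ⟨m', ⟨p₂, q₂, h4, h5, h6, he⟩, hn'⟩
    obtain ⟨rfl, -⟩ := res_eq_iff.1 he
    exact (hn p₁ q₁ ⟨h1, h2, h3, rfl⟩).symm.trans (hn' p₁ q₁ ⟨h1, h2, h3, rfl⟩)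
  have W_congr : ∀ p p' q m, AgreeBelow m p p' → ∀ n, W p (res q m) n → W p' (res q m) n := by
    rintro p p' q m ha n ⟨m', ⟨p₁, q₁, h1, h2, h3, he⟩, hn⟩
    obtain ⟨rfl, -⟩ := res_eq_iff.1 he
    exact ⟨m, ⟨p₁, q₁, h1, h2, ha.symm.trans h3, he⟩, fun p₂ q₂ h => hn p₂ q₂
      ⟨h.1, h.2.1, ha.trans h.2.2.1, h.2.2.2⟩⟩
  let code : Baire M → Baire M := fun p => lam fun c => Omega.mu fun v => ∃ n, v = n.succ ∧ W p c n
  have dcode : DFun M code :=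
    (inferInstance : DFun M fun p : Baire M => lam fun c => Omega.mu fun v =>
      ∃ n, v = n.succ ∧ W p c n)
  have dcode' : ∀ {E : Type u} [Coded M E] (t : E → Baire M) [DFun M t],
    DFun M fun e => code (t e) := fun t => DFun.comp code t
  have code_app : ∀ p c, code p c = Omega.mu fun v => ∃ n, v = n.succ ∧ W p c n :=
    fun p c => lam_app _ c
  have code_iff : ∀ p c n, code p c = n.succ ↔ W p c n := fun p c n => by
    rw [code_app]
    exact mu_succ_iff (P := W p c) (W_unique p c)
  have value : ∀ p q n, (∃ n, F p n) → G (H p) q → (CodedValue (code p) q n ↔ n = K p q) := by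
    intro p q n hp hq
    have sound : ∀ m n, code p (res q m) = n.succ → n = K p q := by
      intro m n h
      obtain ⟨m', ⟨p₁, q₁, h1, h2, h3, he⟩, hn⟩ := (code_iff _ _ _).1 h
      obtain ⟨rfl, -⟩ := res_eq_iff.1 he
      exact (hn p q ⟨hp, hq, AgreeBelow.refl _ _, rfl⟩).symm
    refine ⟨fun ⟨m, hm, _⟩ => sound m n hm, ?_⟩
    rintro rfl
    -- A modulus of `K` at `(p, q)` is long enough to decide. The first deciding prefix may be
    -- shorter, but by `sound` its answer is the same.
    obtain ⟨m₀, hm₀⟩ := cK p q hp hq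
    have h0 : code p (res q m₀) = (K p q).succ := by
      refine (code_iff _ _ _).2 ⟨m₀, ⟨p, q, hp, hq, AgreeBelow.refl _ _, rfl⟩, ?_⟩
      rintro p' q' ⟨hp', hq', ha, he⟩
      exact (hm₀ p' q' hp' hq' ha (res_eq_iff.1 he).2).symm
    obtain ⟨m, hm, hl⟩ := Omega.exists_least (P := fun m => code p (res q m) ≠ 0) inferInstance
      ⟨m₀, h0 ▸ Omega.succ_ne_zero _⟩
    obtain ⟨v, hv⟩ := (Omega.eq_zero_or_succ _).resolve_left hm
    exact ⟨m, sound m v hv ▸ hv, fun l hlm => not_not.1 (hl l hlm)⟩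
  have univ : ∀ p, (∃ n, F p n) → ∀ n, Universal G (join (H p) (code p)) n ↔
      ∃ q, G (H p) q ∧ n = K p q := by
    intro p hp n
    rw [Universal, left_join, right_join]
    constructor
    · rintro ⟨-, q, hq, hv⟩
      exact ⟨q, hq, (value p q n hp hq).1 hv⟩
    · rintro ⟨q, hq, hn⟩
      exact ⟨fun q hq => ⟨_, (value p q _ hp hq).2 rfl⟩, q, hq, (value p q n hp hq).2 hn⟩
  refine ⟨fun p => join (H p) (code p), fun _ q => q 0, inferInstance, inferInstance,
    fun p hp i => ?_,
    fun p q _ _ => ⟨Omega.succ 0, fun p' q' _ _ _ h => h 0 (Omega.lt_succ_self 0)⟩,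
    fun p hp => ⟨?_, fun q hq => ?_⟩⟩
  · by_cases hi : ∃ j, i = pair 0 j
    · obtain ⟨j, rfl⟩ := hi
      obtain ⟨m, hm⟩ := cH p hp j
      exact ⟨m, fun p' hp' ha => by rw [join_app_left, join_app_left, hm p' hp' ha]⟩
    by_cases hi' : ∃ j, i = pair (Omega.succ 0) j
    · obtain ⟨c, rfl⟩ := hi'
      by_cases hc : ∃ q m, c = res q m
      · obtain ⟨q, m, rfl⟩ := hc
        refine ⟨m, fun p' _ ha => ?_⟩
        rw [join_app_right, join_app_right, code_app, code_app]
        congr 1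
        funext v
        exact propext (exists_congr fun n => and_congr_right fun _ =>
          ⟨W_congr _ _ q m ha n, W_congr _ _ q m ha.symm n⟩)
      · refine ⟨0, fun p' _ _ => ?_⟩
        rw [join_app_right, join_app_right, code_app, code_app]
        congr 1
        funext v
        have : ∀ p n, ¬ W p c n := by
          rintro p n ⟨m, ⟨_, q, _, _, _, he⟩, -⟩
          exact hc ⟨q, m, he⟩
        simp [this]
    -- Positions outside both halves of `join` carry the default value of `mu`, independently of
    -- `p`.
    · refine ⟨0, fun p' _ _ => ?_⟩
      rw [join_app, join_app]
      congr 1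
      funext v
      push Not at hi hi'
      simp [hi, hi']
  · obtain ⟨q, hq⟩ := (h p hp).1
    exact ⟨const (K p q), by rw [onZero, const_app, univ p hp]; exact ⟨q, hq, rfl⟩⟩
  · obtain ⟨q', hq', he⟩ := (univ p hp _).1 hq
    dsimp only
    rw [he]
    exact (h p hp).2 q' hq'

theorem exists_isFirstOrderPart (f : Problem M) : ∃ g : M, IsFirstOrderPart f g := by
  have dU := dfn_universal (G := fun p q => f.onNames p.val q.val) f.dfn
  obtain ⟨g, hg, hU⟩ := exists_isFirstOrder _ dU
  refine ⟨g, hg, red_universal.contRed dU f.dfn hU f.presents, fun h hh hr => ?_⟩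
  have dh : Dfn M fun e : Baire M × Omega M => Rel h e.1.val e.2.val := inferInstance
  have hP := presents_firstOrder hh
  have := (Red.of_contRed hP f.presents hr).to_universal f.dfn dh
  exact this.contRed dh (Dfn.comp₂ dU (fun e : Baire M × Baire M => e.1)
    fun e : Baire M × Baire M => e.2 0) hP hU

/-! ### The dichotomy for first-order parts -/

theorem IsFirstOrderPart.dichotomy (hAD : AD M) {f : Problem M} {g : M}
    (hg : IsFirstOrderPart f g) :
    Xor (ContRed (firstOrderOnNames g) closedChoice) (ContRed pi2ACC f.onNames) := by
  obtain ⟨hfo, hgf, hmax⟩ := hg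
  have dg : Dfn M fun e : Baire M × Omega M => Rel g e.1.val e.2.val := inferInstance
  have dP : Dfn M fun e : Baire M × Omega M => Pi2Choice e.1 e.2 := inferInstance
  have dN : Dfn M fun e : Baire M × Omega M => NotLimit e.1 e.2 := inferInstance
  have hP := presents_firstOrder hfo
  have hred := Red.of_contRed hP f.presents hgf
  have part_le (h : ContRed (firstOrderOnNames g) closedChoice) :=
    Red.of_contRed hP presents_closedChoice h
  rcases WeihrauchAD.dichotomy hAD (F := fun p n => Rel g p.val n.val) dg with h | h
  · refine Or.inl ⟨h.contRed dg (by unfold onZero; infer_instance) hP presents_closedChoice,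
      fun hf => ?_⟩
    -- Maximality of `g` speaks of problems given by sets, so `Π⁰₂ACC` is first replaced by a set
    -- `a`. Then `NotLimit` lies below `Π⁰₂ACC`, hence below `g`, hence below closed choice, which
    -- is impossible.
    obtain ⟨a, ha, hPa⟩ := exists_isFirstOrder _ dP
    have hPf := Red.of_contRed presents_pi2ACC f.presents hf
    have hPg := Red.of_contRed hPa hP (hmax a ha (hPf.contRed dP f.dfn hPa f.presents))
    exact not_red_notLimit ((red_notLimit_pi2Choice.trans hPg dN).trans h dN)
  · refine Or.inr ⟨((red_pi2Choice_notLimit.trans h dP).trans hred dP).contRed dP f.dfn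
      presents_pi2ACC f.presents, fun hc => ?_⟩
    exact not_red_notLimit (h.trans (part_le hc) dN)

end FirstOrderPart

end WeihrauchAD

theorem theorem30 (M : Type u) [SetStructure M] (hZF : IsZF M) (hDC : DC M) (hAD : AD M)
    (f : Problem M) :
    (∃ g : M, IsFirstOrderPart f g) ∧
      ∀ g : M, IsFirstOrderPart f g →
        Xor (ContRed (firstOrderOnNames g) closedChoice) (ContRed pi2ACC f.onNames) :=
  have : ZFModel M := ⟨hZF⟩
  ⟨exists_isFirstOrderPart f, fun _ hg => hg.dichotomy hAD⟩
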